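/- **Setting.** There are $N$ sources with unknown reliabilities $\alpha=(\alpha_1,\dots,\alpha_N)\in[0,1]^N$. In each round $t=1,2,\dots$ a (possibly randomized) policy, given the history so far, selects a set $A_t\subseteq\{1,\dots,N\}$ with $|A_t|=K$, and then observes the indicators $z_{i,t}$, $i\in A_t$, which are fresh independent variables $z_{i,t}\sim\mathrm{Bernoulli}(\alpha_i)$. Let $\varepsilon>0$, and let $G$ be a known positive semidefinite $N\times N$ matrix with $G_{S,S}$ positive definite for every $|S|=K$. Put $$g(S)=\log\det G_{S,S},\qquad r(a,\varepsilon)=2\bigl[a\log(1+\varepsilon)+(1-a)\log\varepsilon\bigr],\qquad \beta_\varepsilon=2\log\tfrac{1+\varepsilon}{\varepsilon},$$ $$f(S)=g(S)+\sum_{i\in S}r(\alpha_i,\varepsilon),\qquad \mathrm{Reg}_T=\sum_{t=1}^T\bigl(\max_{|S|=K}f(S)-f(A_t)\bigr).$$ Let $\mathrm{kl}(p\|q)=p\log\frac pq+(1-p)\log\frac{1-p}{1-q}\in[0,\infty]$ be the divergence of Bernoulli laws, with the usual conventions. For fixed $(N,K,G,\varepsilon)$ a policy is *consistent* if $\mathbb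 E[\mathrm{Reg}_T]/T^p\to0$ for every $p>0$ and every $\alpha\in[0,1]^N$. **The ProbDPP algorithm** with constant $c>0$: in round $t$ let $n_i$ be the number of previous selections of $i$ and $\hat\alpha_i$ the empirical mean of its observed indicators. Put $U_i=1$ if $n_i=0$, and otherwise $U_i=\max\{u\in[0,1]: n_i\,\mathrm{kl}(\hat\alpha_i\|u)\le\log t+c\log\log t\}$ (a negative right-hand side, possible only for $t=2$, is read as $0$). Play any maximizer of $g(S)+\sum_{i\in S}r(U_i,\varepsilon)$ over $|S|=K$, with arbitrary tie-breaking. The *restricted instance* is the case $K=1$ with $g$ constant on singletons. **Theorem.** Let $\varepsilon>0$ and $c>0$. 1. On the restricted instance, for every consistent policy, every $\alpha\in[0,1]^N$ and every $i^\star\in\arg\max_i\alpha_i$, $$\liminf_{T\to\infty}\frac{\mathbb E[\mathrm{Reg}_T]}{\log T}\ \ge\ \sum_{i:\,\alpha_i<\alpha_{i^\star}}\frac{\Delta_i}{\mathrm{kl}(\alpha_i\|\alpha_{i^\star})},\qquad \Delta_i=\beta_\varepsilon(\alpha_{i^\star}-\alpha_i),$$ where a term with $\mathrm{kl}(\alpha_i\|\alpha_{i^\star})=\infty$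 (which occurs exactly when $\alpha_{i^\star}=1$) is $0$. 2. On the restricted instance with $N\ge2$, no policy satisfies $\mathbb E[\mathrm{Reg}_T]=o(\log T)$ for all $\alpha\in[0,1]^N$. 3. The ProbDPP algorithm is order-optimal in $T$: for all $N,K,G$ as above and all $\alpha\in[0,1]^N$ it satisfies $\mathbb E[\mathrm{Reg}_T]=O(\log T)$, with a constant that may depend on the instance. On the restricted instance it is consistent, and whenever $\max_i\alpha_i<1$ and the $\alpha_i$ are not all equal, its regret satisfies $\mathbb E[\mathrm{Reg}_T]=\Theta(\log T)$ and is $O$ of the expected regret of any consistent policy on the same instance $\alpha$. -/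

import Mathlib

open Filter Asymptotics
open scoped ENNReal Topology unitInterval

namespace ProbDPP

noncomputable section

/-- An action: a subset of the `N` sources with exactly `K` elements. -/
abbrev Action (N K : ℕ) : Type := {S : Finset (Fin N) // S.card = K}

/-- What the learner sees in one round: the selected subset together with the success
indicators of the selected sources only (semi-bandit feedback). -/
abbrev Round (N K : ℕ) : Type := Σ S : Action N K, (S.1 → Bool)

/-- The history of the first `t` rounds. -/
abbrev History (N K t : ℕ) : Type := Fin t → Round N K

/-- A (possibly randomized) policy: after each history of `t` rounds, the law of the action
played in round `t + 1`. -/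
abbrev Policy (N K : ℕ) : Type := (t : ℕ) → History N K t → PMF (Action N K)

/-- The mass that the Bernoulli law with success probability `p` gives to `b`. -/
def bernoulliMass (p : I) (b : Bool) : ℝ≥0∞ :=
  if b then ENNReal.ofReal (p : ℝ) else ENNReal.ofReal (1 - (p : ℝ))

lemma sum_bernoulliMass (p : I) : ∑ b : Bool, bernoulliMass p b = 1 := by
  have h0 : (0 : ℝ) ≤ p := p.2.1
  have h1 : (0 : ℝ) ≤ 1 - p := sub_nonneg.2 p.2.2
  simp [bernoulliMass, ← ENNReal.ofReal_add h0 h1]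

/-- The joint law of the indicators `z i`, `i ∈ S`: independent, `z i ∼ Bernoulli (α i)`. -/
def feedback {N : ℕ} (α : Fin N → I) (S : Finset (Fin N)) : PMF (S → Bool) :=
  PMF.ofFintype (fun z => ∏ i : S, bernoulliMass (α i) (z i)) (by
    have h := Finset.prod_univ_sum (fun _ : S => (Finset.univ : Finset Bool))
      (fun i b => bernoulliMass (α i) b)
    rw [Fintype.piFinset_univ] at h
    rw [← h]
    exact Finset.prod_eq_one fun i _ => sum_bernoulliMass _)

/-- The law of the history of the first `t` rounds when policy `π` interacts with sources of
reliabilities `α`: in each round an action is drawn from the policy, and then fresh indicators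
are drawn for the selected sources. -/
def historyLaw {N K : ℕ} (π : Policy N K) (α : Fin N → I) : (t : ℕ) → PMF (History N K t)
  | 0 => PMF.pure Fin.elim0
  | t + 1 =>
    (historyLaw π α t).bind fun h =>
      (π t h).bind fun S =>
        (feedback α S.1).map fun z =>
          (Fin.snoc (α := fun _ => Round N K) h ⟨S, z⟩ : History N K (t + 1))

/-- The diversity score `g(S) = log det G_{S,S}`. -/
def diversity {N : ℕ} (G : Matrix (Fin N) (Fin N) ℝ) (S : Finset (Fin N)) : ℝ :=
  Real.log (G.submatrix (fun i : S => (i : Fin N)) (fun i : S => (i : Fin N))).det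

/-- `G` is positive semidefinite and its principal `K × K` submatrices are positive definite, so
that `g(S)` is a genuine real number for every action `S`. -/
structure IsKernel {N : ℕ} (K : ℕ) (G : Matrix (Fin N) (Fin N) ℝ) : Prop where
  posSemidef : G.PosSemidef
  posDef : ∀ S : Finset (Fin N), S.card = K →
    (G.submatrix (fun i : S => (i : Fin N)) (fun i : S => (i : Fin N))).PosDef

/-- The kernels of the restricted instance: `K = 1` and `g` is constant on singletons. -/
structure IsRestricted {N : ℕ} (G : Matrix (Fin N) (Fin N) ℝ) : Prop where
  isKernel : IsKernel 1 G
  diversity_const : ∀ i j : Fin N, diversity G {i} = diversity G {j}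

/-- The reliability term `r(a, ε) = 2 [a log (1 + ε) + (1 - a) log ε]`. -/
def reliabilityReward (ε a : ℝ) : ℝ :=
  2 * (a * Real.log (1 + ε) + (1 - a) * Real.log ε)

/-- The objective `g(S) + ∑_{i ∈ S} r(a i, ε)`. -/
def objective {N : ℕ} (G : Matrix (Fin N) (Fin N) ℝ) (ε : ℝ) (a : Fin N → ℝ)
    (S : Finset (Fin N)) : ℝ :=
  diversity G S + ∑ i ∈ S, reliabilityReward ε (a i)

/-- The value `f(A⋆)` of a best fixed action. -/
def optValue {N : ℕ} (K : ℕ) (G : Matrix (Fin N) (Fin N) ℝ) (ε : ℝ) (a : Fin N → ℝ) : ℝ :=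
  ⨆ S : Action N K, objective G ε a S.1

/-- The pseudo-regret `∑_t (f(A⋆) - f(A_t))` along a history. -/
def regret {N K : ℕ} (G : Matrix (Fin N) (Fin N) ℝ) (ε : ℝ) (α : Fin N → I) {T : ℕ}
    (h : History N K T) : ℝ :=
  ∑ t : Fin T, (optValue K G ε (fun i => (α i : ℝ)) -
    objective G ε (fun i => (α i : ℝ)) (h t).1.1)

/-- The expected pseudo-regret `E[Reg_T]` of the policy `π` (a finite sum over histories). -/
def expectedRegret {N K : ℕ} (G : Matrix (Fin N) (Fin N) ℝ) (ε : ℝ) (π : Policy N K)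
    (α : Fin N → I) (T : ℕ) : ℝ :=
  ∑ h : History N K T, (historyLaw π α T h).toReal * regret G ε α h

/-- A policy is consistent if its expected regret is subpolynomial on every instance:
`E[Reg_T] / T ^ p → 0` for every `p > 0` and all reliabilities in `[0, 1]`. -/
def IsConsistent {N K : ℕ} (G : Matrix (Fin N) (Fin N) ℝ) (ε : ℝ) (π : Policy N K) : Prop :=
  ∀ α : Fin N → I, ∀ p : ℝ, 0 < p →
    Tendsto (fun T : ℕ => expectedRegret G ε π α T / (T : ℝ) ^ p) atTop (𝓝 0)

/-- The divergence `kl(p ‖ q) = p log (p / q) + (1 - p) log ((1 - p) / (1 - q))` of Bernoulli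
laws, with `0 log 0 = 0`, and equal to `∞` when the first law is not absolutely continuous with
respect to the second one. -/
def kl (p q : ℝ) : ℝ≥0∞ :=
  if (q = 0 ∧ p ≠ 0) ∨ (q = 1 ∧ p ≠ 1) then ∞
  else ENNReal.ofReal (p * Real.log (p / q) + (1 - p) * Real.log ((1 - p) / (1 - q)))

/-- The scale `β_ε = 2 log ((1 + ε) / ε)`. -/
def scale (ε : ℝ) : ℝ := 2 * Real.log ((1 + ε) / ε)

/-- The number of rounds in which source `i` was selected. -/
def pulls {N K t : ℕ} (h : History N K t) (i : Fin N) : ℕ :=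
  (Finset.univ.filter fun s : Fin t => i ∈ (h s).1.1).card

/-- The number of observed successes of source `i`. -/
def successes {N K t : ℕ} (h : History N K t) (i : Fin N) : ℕ :=
  (Finset.univ.filter fun s : Fin t => ∃ hi : i ∈ (h s).1.1, (h s).2 ⟨i, hi⟩ = true).card

/-- The empirical reliability of source `i`. -/
def empiricalMean {N K t : ℕ} (h : History N K t) (i : Fin N) : ℝ :=
  (successes h i : ℝ) / (pulls h i : ℝ)

/-- The KL-UCB index of source `i` in round `t + 1`, computed from the history `h` of the first
`t` rounds: `1` if `i` has not been selected yet, and otherwise the largest `u ∈ [0, 1]` with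
`n_i kl(α̂_i ‖ u) ≤ log (t + 1) + c log log (t + 1)`; a negative right-hand side, which occurs
in round `2` at most, is read as `0`. -/
def klUCB {N K t : ℕ} (c : ℝ) (h : History N K t) (i : Fin N) : ℝ :=
  if pulls h i = 0 then 1
  else sSup {u : ℝ | u ∈ Set.Icc (0 : ℝ) 1 ∧
    (pulls h i : ℝ≥0∞) * kl (empiricalMean h i) u ≤
      ENNReal.ofReal (Real.log ((t : ℝ) + 1) + c * Real.log (Real.log ((t : ℝ) + 1)))}

/-- The policy `π` is an implementation of the ProbDPP algorithm: in every round it plays a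
maximizer of the optimistic objective `g(a) + ⟨a, r̃⟩`, where `r̃_i = r(U_i, ε)`, with ties broken
in an arbitrary (possibly randomized) way. -/
def IsProbDPP {N K : ℕ} (G : Matrix (Fin N) (Fin N) ℝ) (ε c : ℝ) (π : Policy N K) : Prop :=
  ∀ (t : ℕ) (h : History N K t), ∀ S ∈ (π t h).support, ∀ S' : Action N K,
    objective G ε (klUCB c h) S'.1 ≤ objective G ε (klUCB c h) S.1

end

end ProbDPP

namespace ProbDPP

/-! ### Expectations over finite histories and their one-round recursions. -/

noncomputable section

/-! All expectations are finite sums over histories, and both halves of the theorem rest on one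
change of measure. Altering the reliability of a single source i changes the probability of a
history only through the Bernoulli likelihood of the counts of i, since the factors of the policy
and of the other sources are the same under both instances (`historyLaw_likelihood_update`).

Upper bound. If every index is at least α_j - η and the index of every played source is at most α_j
+ η, then the optimistic maximizer has gap at most 2 β_ε K η, hence gap 0 once η is small, there
being finitely many actions (`exists_margin`, `gap_le_of_isProbDPP`). It remains to count the rounds
with a bad index. Adaptive sampling is handled without martingales: a union bound over the possible
counts (n, s) of i, changing measure to the maximum likelihood parameter s/n each time, bounds by ∑
(n+1) θ(n) the probability that the true likelihood is at most θ(n) times the maximal one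
(`prob_le_of_likelihood_le`). Underestimation fits θ(n) = ρ^n/(t+1): the budget supplies 1/(t+1),
the margin η supplies ρ^n and makes the sum over n converge, and summing over t costs O(log T).
Overestimation is charged to the first O(log T) selections of i, after which its probability is at
most 1/T per round.

Lower bound. Raise a suboptimal source i to a reliability q just above the optimum. A consistent
policy must select i rarely in the old instance and almost always in the new one, so the event that
i is played in more than half of the rounds separates the two laws up to errors T^(p-1). The
Bretagnolle-Huber inequality (`exp_neg_half_le_sqrt_add_sqrt`) turns this into E[N_i] kl(α_i‖q) ≥
(1-p) log T - 2 log 2, where N_i counts the selections of i. Letting q decrease to the optimum and p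
to 0, then adding up the gaps, gives the bound. The remaining claims follow: regret o(log T)
everywhere would imply consistency and contradict the bound, and O(log T) meets it in order. -/

lemma sum_bind_toReal {A B : Type*} [Fintype A] [Fintype B] (p : PMF A) (f : A → PMF B)
    (φ : B → ℝ) :
    ∑ b, (p.bind f b).toReal * φ b = ∑ a, (p a).toReal * ∑ b, (f a b).toReal * φ b := by
  have h : ∀ b, (p.bind f b).toReal = ∑ a, (p a).toReal * (f a b).toReal := by
    intro b
    rw [PMF.bind_apply, tsum_fintype, ENNReal.toReal_sum
      (fun a _ => ENNReal.mul_ne_top (p.apply_ne_top a) ((f a).apply_ne_top b))]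
    simp
  simp only [h, Finset.sum_mul, Finset.mul_sum]
  rw [Finset.sum_comm]
  simp [mul_assoc]

lemma sum_pure_toReal {B : Type*} [Fintype B] (b₀ : B) (φ : B → ℝ) :
    ∑ b, (PMF.pure b₀ b).toReal * φ b = φ b₀ := by
  classical
  rw [Finset.sum_eq_single b₀] <;> simp +contextual [PMF.pure_apply]

lemma sum_map_toReal {A B : Type*} [Fintype A] [Fintype B] (p : PMF A) (f : A → B)
    (φ : B → ℝ) :
    ∑ b, (p.map f b).toReal * φ b = ∑ a, (p a).toReal * φ (f a) := by
  rw [PMF.map, sum_bind_toReal]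
  exact Finset.sum_congr rfl fun a _ => congrArg _ (sum_pure_toReal _ _)

lemma sum_toReal {A : Type*} [Fintype A] (p : PMF A) : ∑ a, (p a).toReal = 1 := by
  have h := p.tsum_coe
  rw [tsum_fintype] at h
  rw [← ENNReal.toReal_sum (fun a _ => p.apply_ne_top a), h, ENNReal.toReal_one]

variable {N K : ℕ}

/-- Append one round to a history. -/
def extend {t : ℕ} (h : History N K t) (S : Action N K) (z : S.1 → Bool) :
    History N K (t + 1) :=
  Fin.snoc (α := fun _ => Round N K) h ⟨S, z⟩

/-- The expectation of a function of the history of the first `t` rounds. -/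
def expect (π : Policy N K) (α : Fin N → I) (t : ℕ) (φ : History N K t → ℝ) : ℝ :=
  ∑ h, (historyLaw π α t h).toReal * φ h

lemma expectedRegret_eq (G : Matrix (Fin N) (Fin N) ℝ) (ε : ℝ) (π : Policy N K)
    (α : Fin N → I) (T : ℕ) :
    expectedRegret G ε π α T = expect π α T (regret G ε α) := rfl

lemma expect_zero (π : Policy N K) (α : Fin N → I) (φ : History N K 0 → ℝ) :
    expect π α 0 φ = φ Fin.elim0 := sum_pure_toReal _ _

lemma expect_succ (π : Policy N K) (α : Fin N → I) (t : ℕ) (φ : History N K (t + 1) → ℝ) :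
    expect π α (t + 1) φ = expect π α t fun h =>
      ∑ S, (π t h S).toReal * ∑ z, (feedback α S.1 z).toReal * φ (extend h S z) := by
  unfold expect
  rw [historyLaw, sum_bind_toReal]
  simp only [sum_bind_toReal, sum_map_toReal]
  rfl

section expect
variable (π : Policy N K) (α : Fin N → I) (t : ℕ)

lemma expect_mono {φ ψ : History N K t → ℝ} (h : ∀ x, φ x ≤ ψ x) :
    expect π α t φ ≤ expect π α t ψ :=
  Finset.sum_le_sum fun x _ => mul_le_mul_of_nonneg_left (h x) ENNReal.toReal_nonneg

lemma expect_const (a : ℝ) : expect π α t (fun _ => a) = a := by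
  rw [expect, ← Finset.sum_mul, sum_toReal, one_mul]

lemma expect_nonneg {φ : History N K t → ℝ} (h : ∀ x, 0 ≤ φ x) : 0 ≤ expect π α t φ :=
  Finset.sum_nonneg fun x _ => mul_nonneg ENNReal.toReal_nonneg (h x)

lemma expect_add (φ ψ : History N K t → ℝ) :
    expect π α t (fun h => φ h + ψ h) = expect π α t φ + expect π α t ψ := by
  simp [expect, mul_add, Finset.sum_add_distrib]

lemma expect_const_mul (a : ℝ) (φ : History N K t → ℝ) :
    expect π α t (fun h => a * φ h) = a * expect π α t φ := by
  simp only [expect, Finset.mul_sum]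
  exact Finset.sum_congr rfl fun x _ => by ring

lemma expect_sum {ι : Type*} (s : Finset ι) (φ : ι → History N K t → ℝ) :
    expect π α t (fun h => ∑ i ∈ s, φ i h) = ∑ i ∈ s, expect π α t (φ i) := by
  simp only [expect, Finset.mul_sum]
  exact Finset.sum_comm

/-- Increments that depend on the past and the current action only. -/
lemma expect_succ_of_extend {φ : History N K (t + 1) → ℝ} {φ₀ : History N K t → ℝ}
    {ψ : History N K t → Action N K → ℝ}
    (h : ∀ x S z, φ (extend x S z) = φ₀ x + ψ x S) :
    expect π α (t + 1) φ =
      expect π α t φ₀ + expect π α t fun x => ∑ S, (π t x S).toReal * ψ x S := by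
  rw [expect_succ, ← expect_add]
  congr 1
  funext x
  simp only [h, ← Finset.sum_mul, sum_toReal, one_mul, mul_add, Finset.sum_add_distrib]

end expect

lemma sum_extend {t : ℕ} (h : History N K t) (S : Action N K) (z : S.1 → Bool)
    (F : Round N K → ℝ) : ∑ s, F (extend h S z s) = ∑ s, F (h s) + F ⟨S, z⟩ := by
  rw [Fin.sum_univ_castSucc]
  simp [extend]

lemma pulls_eq_sum {t : ℕ} (h : History N K t) (i : Fin N) :
    pulls h i = ∑ s, if i ∈ (h s).1.1 then 1 else 0 := by
  simp [pulls]

/-- Whether source `i` is observed to be successful in a round. -/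
def Hit (i : Fin N) (r : Round N K) : Prop := ∃ hi : i ∈ r.1.1, r.2 ⟨i, hi⟩ = true

open Classical in
lemma successes_eq_sum {t : ℕ} (h : History N K t) (i : Fin N) :
    successes h i = ∑ s, if Hit i (h s) then 1 else 0 := by
  simp only [successes, Hit, Finset.card_filter]
  exact Finset.sum_congr rfl fun s _ => by congr

lemma pulls_extend {t : ℕ} (h : History N K t) (S : Action N K) (z : S.1 → Bool) (i : Fin N) :
    pulls (extend h S z) i = pulls h i + if i ∈ S.1 then 1 else 0 := by
  rw [pulls_eq_sum, pulls_eq_sum, Fin.sum_univ_castSucc]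
  simp [extend]

open Classical in
lemma successes_extend {t : ℕ} (h : History N K t) (S : Action N K) (z : S.1 → Bool)
    (i : Fin N) :
    successes (extend h S z) i = successes h i + if Hit i ⟨S, z⟩ then 1 else 0 := by
  rw [successes_eq_sum, successes_eq_sum, Fin.sum_univ_castSucc]
  simp [extend]

lemma successes_le_pulls {t : ℕ} (h : History N K t) (i : Fin N) :
    successes h i ≤ pulls h i := by
  refine Finset.card_le_card fun s hs => ?_
  simp only [Finset.mem_filter, Finset.mem_univ, true_and] at hs ⊢
  exact hs.1

lemma pulls_le {t : ℕ} (h : History N K t) (i : Fin N) : pulls h i ≤ t := by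
  simpa [pulls] using Finset.card_filter_le (Finset.univ : Finset (Fin t)) _

lemma regret_extend (G : Matrix (Fin N) (Fin N) ℝ) (ε : ℝ) (α : Fin N → I) {t : ℕ}
    (h : History N K t) (S : Action N K) (z : S.1 → Bool) :
    regret G ε α (extend h S z) = regret G ε α h +
      (optValue K G ε (fun i => (α i : ℝ)) - objective G ε (fun i => (α i : ℝ)) S.1) :=
  sum_extend h S z fun r =>
    optValue K G ε (fun i => (α i : ℝ)) - objective G ε (fun i => (α i : ℝ)) r.1.1

/-! ### Likelihood of one source and change of measure. -/

/-- The factor of the likelihood of a history that source `i` contributes when its reliability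
is `q`. -/
def likelihood {t : ℕ} (i : Fin N) (q : ℝ) (h : History N K t) : ℝ :=
  q ^ successes h i * (1 - q) ^ (pulls h i - successes h i)

/-- The factor that source `i` contributes in a single round. -/
def roundLikelihood (i : Fin N) (q : ℝ) (S : Finset (Fin N)) (z : S → Bool) : ℝ :=
  if hi : i ∈ S then (if z ⟨i, hi⟩ then q else 1 - q) else 1

lemma likelihood_extend {t : ℕ} (i : Fin N) (q : ℝ) (h : History N K t) (S : Action N K)
    (z : S.1 → Bool) :
    likelihood i q (extend h S z) = likelihood i q h * roundLikelihood i q S.1 z := by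
  classical
  have hle := successes_le_pulls h i
  rw [likelihood, likelihood, pulls_extend, successes_extend, roundLikelihood]
  by_cases hi : i ∈ S.1
  · by_cases hz : z ⟨i, hi⟩ = true
    · have : Hit i ⟨S, z⟩ := ⟨hi, hz⟩
      have e : pulls h i + 1 - (successes h i + 1) = pulls h i - successes h i := by omega
      simp only [this, hi, hz, if_true, dif_pos, e]
      ring
    · have : ¬ Hit i ⟨S, z⟩ := fun ⟨_, h2⟩ => hz h2
      have e : pulls h i + 1 - (successes h i + 0) = pulls h i - successes h i + 1 := by omega
      simp only [this, hi, hz, if_true, if_false, dif_pos, e]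
      simp [pow_succ]
      ring
  · have : ¬ Hit i ⟨S, z⟩ := fun h2 => hi h2.1
    simp [this, hi]

lemma toReal_bernoulliMass (p : I) (b : Bool) :
    (bernoulliMass p b).toReal = if b then (p : ℝ) else 1 - (p : ℝ) := by
  cases b <;> simp [bernoulliMass, p.2.1, p.2.2]

lemma toReal_feedback (α : Fin N → I) (S : Finset (Fin N)) (z : S → Bool) :
    (feedback α S z).toReal = ∏ j : S, if z j then (α j : ℝ) else 1 - (α j : ℝ) := by
  simp [feedback, ENNReal.toReal_prod, toReal_bernoulliMass]

/-- Cross-multiplied rather than written as a ratio, so that reliabilities 0 and 1 need no separate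
treatment. -/
lemma feedback_update (α : Fin N → I) (i : Fin N) (q : I) (S : Finset (Fin N)) (z : S → Bool) :
    (feedback α S z).toReal * roundLikelihood i q S z =
      (feedback (Function.update α i q) S z).toReal * roundLikelihood i (α i) S z := by
  classical
  rw [toReal_feedback, toReal_feedback, roundLikelihood, roundLikelihood]
  by_cases hi : i ∈ S
  · simp only [hi, dif_pos]
    rw [Fintype.prod_eq_mul_prod_compl (⟨i, hi⟩ : S), Fintype.prod_eq_mul_prod_compl (⟨i, hi⟩ : S)]
    have : ∏ j ∈ ({⟨i, hi⟩} : Finset S)ᶜ,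
        (if z j then ((Function.update α i q) j : ℝ) else 1 - ((Function.update α i q) j : ℝ)) =
        ∏ j ∈ ({⟨i, hi⟩} : Finset S)ᶜ, (if z j then (α j : ℝ) else 1 - (α j : ℝ)) := by
      refine Finset.prod_congr rfl fun j hj => ?_
      have : (j : Fin N) ≠ i := by
        rintro rfl
        simp at hj
      simp [Function.update_of_ne this]
    rw [this]
    simp only [Function.update_self]
    ring
  · simp only [hi, dif_neg, not_false_eq_true, mul_one]
    refine Finset.prod_congr rfl fun j _ => ?_
    have : (j : Fin N) ≠ i := by
      rintro rfl
      exact hi j.2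
    simp [Function.update_of_ne this]

/-- Change of measure between two instances that differ in source `i` only. -/
lemma expect_likelihood_update (π : Policy N K) (α : Fin N → I) (i : Fin N) (q : I) (t : ℕ)
    (φ : History N K t → ℝ) :
    expect π α t (fun h => likelihood i q h * φ h) =
      expect π (Function.update α i q) t (fun h => likelihood i (α i) h * φ h) := by
  induction t with
  | zero => simp [expect_zero, likelihood, pulls, successes]
  | succ t ih =>
    have key : ∀ (β : Fin N → I) (r : ℝ),
        expect π β (t + 1) (fun h => likelihood i r h * φ h) =
          expect π β t (fun h => likelihood i r h *
            ∑ S, (π t h S).toReal * ∑ z, ((feedback β S.1 z).toReal * roundLikelihood i r S.1 z) *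
              φ (extend h S z)) := by
      intro β r
      rw [expect_succ]
      congr 1
      funext h
      simp only [likelihood_extend, Finset.mul_sum]
      refine Finset.sum_congr rfl fun S _ => Finset.sum_congr rfl fun z _ => by ring
    rw [key, key, ih]
    congr 1
    funext h
    congr 1
    refine Finset.sum_congr rfl fun S _ => ?_
    congr 1
    exact Finset.sum_congr rfl fun z _ => by rw [feedback_update]

/-- The pointwise form of the change of measure, obtained by testing it on the indicator of one
history. -/
lemma historyLaw_likelihood_update (π : Policy N K) (α : Fin N → I) (i : Fin N) (q : I) {t : ℕ}
    (h : History N K t) :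
    (historyLaw π α t h).toReal * likelihood i q h =
      (historyLaw π (Function.update α i q) t h).toReal * likelihood i (α i) h := by
  classical
  have := expect_likelihood_update π α i q t (fun x => if x = h then 1 else 0)
  simpa [expect] using this

/-- The sum over outcomes factors over the sources; every factor but that of i sums to 1. -/
lemma sum_feedback_hit (α : Fin N → I) (S : Action N K) (i : Fin N) (hi : i ∈ S.1) :
    ∑ z, (feedback α S.1 z).toReal * (if z ⟨i, hi⟩ then 1 else 0) = (α i : ℝ) := by
  classical
  have h := Finset.prod_univ_sum (fun _ : S.1 => (Finset.univ : Finset Bool))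
    (fun j b => (if b then (α j : ℝ) else 1 - (α j : ℝ)) *
      if j = ⟨i, hi⟩ then (if b then (1 : ℝ) else 0) else 1)
  rw [Fintype.piFinset_univ] at h
  have h1 : ∀ z : S.1 → Bool, (feedback α S.1 z).toReal * (if z ⟨i, hi⟩ then 1 else 0) =
      ∏ j : S.1, (if z j then (α j : ℝ) else 1 - (α j : ℝ)) *
        if j = ⟨i, hi⟩ then (if z j then (1 : ℝ) else 0) else 1 := by
    intro z
    rw [Finset.prod_mul_distrib, toReal_feedback, Finset.prod_ite_eq']
    simp
  rw [Finset.sum_congr rfl fun z _ => h1 z, ← h, Finset.prod_eq_single ⟨i, hi⟩]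
  · simp
  · intro j _ hj
    simp [hj]
  · simp

/-- The indicators are unbiased: a source succeeds in expectation `α i` times per selection. -/
lemma expect_successes (π : Policy N K) (α : Fin N → I) (i : Fin N) (t : ℕ) :
    expect π α t (fun h => (successes h i : ℝ)) =
      α i * expect π α t (fun h => (pulls h i : ℝ)) := by
  classical
  induction t with
  | zero => simp [expect_zero, pulls, successes]
  | succ t ih =>
    have h2 : expect π α (t + 1) (fun h => (pulls h i : ℝ)) = _ :=
      expect_succ_of_extend π α t (φ₀ := fun h => (pulls h i : ℝ))
        (ψ := fun _ S => if i ∈ S.1 then 1 else 0)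
        (fun x S z => by rw [pulls_extend]; push_cast; simp)
    rw [h2, mul_add, ← ih, expect_succ, ← expect_const_mul, ← expect_add]
    congr 1
    funext x
    have h3 : ∀ S : Action N K, ∑ z, (feedback α S.1 z).toReal *
        (successes (extend x S z) i : ℝ) = successes x i + α i * if i ∈ S.1 then 1 else 0 := by
      intro S
      have : ∀ z, (successes (extend x S z) i : ℝ) = successes x i +
          if Hit i (⟨S, z⟩ : Round N K) then 1 else 0 := by
        intro z
        rw [successes_extend]
        push_cast
        rfl
      simp only [this, mul_add, Finset.sum_add_distrib, ← Finset.sum_mul, sum_toReal, one_mul]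
      congr 1
      by_cases hi : i ∈ S.1
      · rw [if_pos hi, mul_one, ← sum_feedback_hit α S i hi]
        refine Finset.sum_congr rfl fun z _ => ?_
        congr 1
        simp [Hit, hi]
      · have : ∀ z, ¬ Hit i (⟨S, z⟩ : Round N K) := fun z h => hi h.1
        simp [hi, this]
    simp only [h3, mul_add, Finset.sum_add_distrib, ← Finset.sum_mul, sum_toReal, one_mul]
    congr 1
    rw [Finset.mul_sum]
    exact Finset.sum_congr rfl fun S _ => by ring

end

/-! ### Bernoulli divergence and comparison of likelihoods. -/

noncomputable section

/-- The divergence of Bernoulli laws as a real number, meaningful where `kl` is finite. -/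
def klReal (p q : ℝ) : ℝ := p * Real.log (p / q) + (1 - p) * Real.log ((1 - p) / (1 - q))

lemma kl_self (p : ℝ) : kl p p = 0 := by
  rw [kl, if_neg (by tauto)]
  have h : ∀ x : ℝ, x * Real.log (x / x) = 0 := by
    intro x
    by_cases hx : x = 0 <;> simp [hx]
  simp only [h, add_zero, ENNReal.ofReal_zero]

lemma kl_eq_ofReal {p q : ℝ} (h0 : q ≠ 0) (h1 : q ≠ 1) : kl p q = ENNReal.ofReal (klReal p q) := by
  rw [kl, if_neg (by tauto), klReal]

/-- This is log x ≤ x - 1 at x = √(q/p). Adding the same bound for 1 - p and 1 - q bounds the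
divergence below by the squared Hellinger distance (√p - √q)² + (√(1-p) - √(1-q))². -/
lemma two_mul_sub_sqrt_le_mul_log {p q : ℝ} (hp : 0 ≤ p) (hq : 0 ≤ q) (h : q = 0 → p = 0) :
    2 * p - 2 * (√p * √q) ≤ p * Real.log (p / q) := by
  rcases hp.eq_or_lt with rfl | hp
  · simp
  have hq' : 0 < q := hq.lt_of_ne fun h' => hp.ne' (h h'.symm)
  have hsp := Real.sqrt_pos.2 hp
  have hsq := Real.sqrt_pos.2 hq'
  have h1 : Real.log (√q / √p) ≤ √q / √p - 1 := Real.log_le_sub_one_of_pos (by positivity)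
  have h2 : Real.log (p / q) = -(2 * Real.log (√q / √p)) := by
    rw [Real.log_div hp.ne' hq'.ne', Real.log_div hsq.ne' hsp.ne', Real.log_sqrt hp.le,
      Real.log_sqrt hq]
    ring
  have h3 : p * (√q / √p) = √p * √q := by
    nth_rewrite 1 [← Real.mul_self_sqrt hp.le]
    field_simp
  rw [h2]
  nlinarith [mul_le_mul_of_nonneg_left h1 hp.le]

lemma sq_sub_div_four_le {p q : ℝ} (hp : 0 ≤ p) (hq : 0 ≤ q) (hp1 : p ≤ 1) (hq1 : q ≤ 1) :
    (p - q) ^ 2 / 4 ≤ (√p - √q) ^ 2 := by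
  have h1 : p - q = (√p - √q) * (√p + √q) := by
    nlinarith [Real.mul_self_sqrt hp, Real.mul_self_sqrt hq]
  have h2 : √p ≤ 1 := Real.sqrt_le_one.2 hp1
  have h3 : √q ≤ 1 := Real.sqrt_le_one.2 hq1
  have h4 : (√p + √q) ^ 2 ≤ 4 := by nlinarith [Real.sqrt_nonneg p, Real.sqrt_nonneg q]
  rw [h1, mul_pow]
  nlinarith [sq_nonneg (√p - √q)]

/-- A weak form of Pinsker's inequality. -/
lemma sq_sub_div_four_le_klReal {p q : ℝ} (hp : p ∈ Set.Icc (0 : ℝ) 1)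
    (hq : q ∈ Set.Icc (0 : ℝ) 1) (h0 : q = 0 → p = 0) (h1 : q = 1 → p = 1) :
    (p - q) ^ 2 / 4 ≤ klReal p q := by
  have a := two_mul_sub_sqrt_le_mul_log hp.1 hq.1 h0
  have b := two_mul_sub_sqrt_le_mul_log (sub_nonneg.2 hp.2) (sub_nonneg.2 hq.2)
    (fun h => by linarith [h1 (by linarith)])
  have c := sq_sub_div_four_le hp.1 hq.1 hp.2 hq.2
  rw [klReal]
  nlinarith [sq_nonneg (√(1 - p) - √(1 - q)), Real.mul_self_sqrt hp.1, Real.mul_self_sqrt hq.1,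
    Real.mul_self_sqrt (sub_nonneg.2 hp.2), Real.mul_self_sqrt (sub_nonneg.2 hq.2)]

lemma ofReal_sq_sub_le_kl {p q : ℝ} (hp : p ∈ Set.Icc (0 : ℝ) 1) (hq : q ∈ Set.Icc (0 : ℝ) 1) :
    ENNReal.ofReal ((p - q) ^ 2 / 4) ≤ kl p q := by
  rw [kl]
  split_ifs with h
  · exact le_top
  · push Not at h
    exact ENNReal.ofReal_le_ofReal (sq_sub_div_four_le_klReal hp hq h.1 h.2)

/-- The Bernoulli likelihood under `u` compared with the maximum likelihood. -/
lemma pow_mul_pow_le_exp_klReal {u : ℝ} (hu : u ∈ Set.Ioo (0 : ℝ) 1) {s n : ℕ} (hs : s ≤ n)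
    (hn : n ≠ 0) :
    u ^ s * (1 - u) ^ (n - s) ≤ Real.exp (-(n * klReal (s / n) u)) *
      ((s / n : ℝ) ^ s * (1 - s / n) ^ (n - s)) := by
  have hn' : (0 : ℝ) < n := by positivity
  -- The claim is in fact an equality; `key` treats successes and failures alike, with 0 ^ 0 = 1
  -- covering an empirical mean of 0 or 1.
  have key : ∀ (k : ℕ) (x y : ℝ), 0 < y → 0 ≤ x → n * x = k →
      y ^ k = Real.exp (-(n * (x * Real.log (x / y)))) * x ^ k := by
    intro k x y hy hx hk
    rcases Nat.eq_zero_or_pos k with rfl | hk0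
    · have : x = 0 := by
        have : (n : ℝ) * x = 0 := by simpa using hk
        exact (mul_eq_zero.1 this).resolve_left hn'.ne'
      simp [this]
    · have hx' : 0 < x := by
        refine hx.lt_of_ne fun h => ?_
        have : (k : ℝ) = 0 := by rw [← hk, ← h, mul_zero]
        exact hk0.ne' (by exact_mod_cast this)
      rw [← mul_assoc, hk, Real.log_div hx'.ne' hy.ne']
      have : -(k * (Real.log x - Real.log y)) = k * (Real.log y - Real.log x) := by ring
      rw [this, ← Real.log_div hy.ne' hx'.ne', Real.exp_nat_mul, Real.exp_log (by positivity),
        div_pow]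
      field_simp
  have hsn : (s : ℝ) / n ≤ 1 := (div_le_one hn').2 (by exact_mod_cast hs)
  rw [key s (s / n) u hu.1 (by positivity) (by field_simp),
    key (n - s) (1 - s / n) (1 - u) (by linarith [hu.2]) (by linarith)
      (by rw [Nat.cast_sub hs]; field_simp)]
  refine le_of_eq ?_
  rw [klReal, mul_add, neg_add, Real.exp_add]
  ring

/-- The Bernoulli likelihood of a sample whose mean is at most `u` is exponentially smaller under
a parameter above `u` than under `u`. -/
lemma exists_pow_mul_pow_le {u a : ℝ} (hu : u ∈ Set.Ioo (0 : ℝ) 1) (hua : u < a) (ha : a ≤ 1) :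
    ∃ ρ ∈ Set.Ioo (0 : ℝ) 1, ∀ s n : ℕ, s ≤ n → (s : ℝ) ≤ n * u →
      a ^ s * (1 - a) ^ (n - s) ≤ ρ ^ n * (u ^ s * (1 - u) ^ (n - s)) := by
  obtain ⟨hu0, hu1⟩ := hu
  have hu1' : 0 < 1 - u := sub_pos.2 hu1
  rcases ha.eq_or_lt with rfl | ha1
  -- For a = 1 any ρ in (0, 1) works: a sample with mean at most u < 1 contains a failure unless n =
  -- 0, so its likelihood vanishes.
  · refine ⟨1 / 2, by norm_num, fun s n hs hsn => ?_⟩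
    rcases Nat.eq_zero_or_pos n with rfl | hn
    · obtain rfl : s = 0 := by omega
      simp
    · have : s < n := by
        have : (s : ℝ) < n := hsn.trans_lt (by
          have : (0 : ℝ) < n := by positivity
          nlinarith)
        exact_mod_cast this
      have : n - s ≠ 0 := by omega
      rw [sub_self, zero_pow this, mul_zero]
      positivity
  have ha0 : 0 < a := hu0.trans hua
  have ha1' : 0 < 1 - a := sub_pos.2 ha1
  set x := a / u with hx
  set y := (1 - a) / (1 - u) with hy
  have hx0 : 0 < x := div_pos ha0 hu0
  have hy0 : 0 < y := div_pos ha1' hu1'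
  have hx1 : 1 < x := (one_lt_div hu0).2 hua
  have hy1 : y < 1 := (div_lt_one hu1').2 (by linarith)
  have hρ0 : 0 < x ^ u * y ^ (1 - u) := by positivity
  -- This ρ is exp(-kl(u‖a)); strict weighted AM-GM makes it less than u x + (1-u) y = 1.
  refine ⟨x ^ u * y ^ (1 - u), ⟨hρ0, ?_⟩, fun s n hs hsn => ?_⟩
  · have := (Real.geom_mean_lt_arith_mean2_weighted_iff_of_pos hu0 hu1' hx0.le hy0.le
      (by ring)).2 (by linarith)
    refine this.trans_eq ?_
    rw [hx, hy]
    field_simp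
    ring
  -- Since x > 1 > y, the left side increases with s, so s = n u is the worst case.
  · have h1 : x ^ s * y ^ (n - s) ≤ (x ^ u * y ^ (1 - u)) ^ n := by
      rw [← Real.log_le_log_iff (by positivity) (by positivity),
        Real.log_mul (by positivity) (by positivity), Real.log_pow, Real.log_pow, Real.log_pow,
        Real.log_mul (by positivity) (by positivity), Real.log_rpow hx0, Real.log_rpow hy0,
        Nat.cast_sub hs]
      have h2 := Real.log_pos hx1
      have h3 := Real.log_neg hy0 hy1
      nlinarith [mul_nonneg (sub_nonneg.2 hsn) (sub_nonneg.2 (h3.trans h2).le)]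
    calc a ^ s * (1 - a) ^ (n - s) = (x ^ s * y ^ (n - s)) * (u ^ s * (1 - u) ^ (n - s)) := by
          rw [hx, hy, div_pow, div_pow]
          field_simp
      _ ≤ _ := mul_le_mul_of_nonneg_right h1 (by positivity)

/-- The mirror image of `exists_pow_mul_pow_le`. -/
lemma exists_pow_mul_pow_le' {u a : ℝ} (hu : u ∈ Set.Ioo (0 : ℝ) 1) (hua : a < u) (ha : 0 ≤ a) :
    ∃ ρ ∈ Set.Ioo (0 : ℝ) 1, ∀ s n : ℕ, s ≤ n → n * u ≤ (s : ℝ) →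
      a ^ s * (1 - a) ^ (n - s) ≤ ρ ^ n * (u ^ s * (1 - u) ^ (n - s)) := by
  obtain ⟨ρ, hρ, h⟩ := exists_pow_mul_pow_le (u := 1 - u) (a := 1 - a)
    ⟨by linarith [hu.2], by linarith [hu.1]⟩ (by linarith) (by linarith)
  refine ⟨ρ, hρ, fun s n hs hsn => ?_⟩
  have := h (n - s) n (Nat.sub_le _ _) (by rw [Nat.cast_sub hs]; nlinarith)
  rw [Nat.sub_sub_self hs, sub_sub_cancel, sub_sub_cancel] at this
  linarith

end

/-! ### Deviation bounds for the KL-UCB index. -/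

noncomputable section

variable {N K : ℕ}

open Classical in
/-- The probability of an event that depends on the history of the first `t` rounds. -/
def prob (π : Policy N K) (α : Fin N → I) (t : ℕ) (P : History N K t → Prop) : ℝ :=
  expect π α t fun h => if P h then 1 else 0

lemma prob_le_one (π : Policy N K) (α : Fin N → I) (t : ℕ) (P : History N K t → Prop) :
    prob π α t P ≤ 1 :=
  (expect_mono π α t fun h => by split_ifs <;> norm_num).trans_eq (expect_const π α t 1)

lemma prob_eq_zero (π : Policy N K) (α : Fin N → I) (t : ℕ) {P : History N K t → Prop}
    (h : ∀ x, ¬ P x) : prob π α t P = 0 := by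
  simp [prob, h, expect]

lemma empiricalMean_mem_Icc {t : ℕ} (h : History N K t) (i : Fin N) :
    empiricalMean h i ∈ Set.Icc (0 : ℝ) 1 :=
  ⟨by rw [empiricalMean]; positivity,
    div_le_one_of_le₀ (by exact_mod_cast successes_le_pulls h i) (by positivity)⟩

/-- The maximum likelihood is positive even at the means 0 and 1, where the vanishing base carries
exponent 0; this allows cancelling it after the change of measure. -/
lemma likelihood_empiricalMean_pos {t : ℕ} (h : History N K t) (i : Fin N) :
    0 < likelihood i (empiricalMean h i) h := by
  have hle := successes_le_pulls h i
  have h01 := empiricalMean_mem_Icc h i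
  rw [likelihood]
  refine mul_pos ?_ ?_
  · rcases Nat.eq_zero_or_pos (successes h i) with h0 | h0
    · simp [h0]
    · have : 0 < pulls h i := h0.trans_le hle
      have : 0 < empiricalMean h i := by rw [empiricalMean]; positivity
      positivity
  · rcases Nat.eq_zero_or_pos (pulls h i - successes h i) with h0 | h0
    · simp [h0]
    · have h1 : (successes h i : ℝ) < pulls h i := by exact_mod_cast (by omega)
      have : empiricalMean h i < 1 :=
        (div_lt_one (by linarith [Nat.cast_nonneg (α := ℝ) (successes h i)])).2 h1
      have : 0 < 1 - empiricalMean h i := sub_pos.2 this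
      positivity

/-- An event on which the likelihood is much smaller than the maximum likelihood is unlikely:
union bound over the possible values of the counts of source `i`, with a change of measure to the
respective maximum likelihood parameter. -/
lemma prob_le_of_likelihood_le (π : Policy N K) (α : Fin N → I) (t : ℕ) (i : Fin N)
    (P : History N K t → Prop) (θ : ℕ → ℝ) (hθ : ∀ n, 0 ≤ θ n)
    (H : ∀ h, P h → likelihood i (α i) h ≤
      θ (pulls h i) * likelihood i (empiricalMean h i) h) :
    prob π α t P ≤ ∑ n ∈ Finset.range (t + 1), ((n : ℝ) + 1) * θ n := by
  classical
  -- The alternatives are indexed by counts, hence deterministic and finite in number; each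
  -- contributes total mass 1 in the union bound.
  set β : ℕ → ℕ → Fin N → I := fun n s =>
    Function.update α i (Set.projIcc (0 : ℝ) 1 zero_le_one ((s : ℝ) / n)) with hβ
  have h1 : ∀ h : History N K t, (historyLaw π α t h).toReal * (if P h then 1 else 0) ≤
      ∑ n ∈ Finset.range (t + 1), ∑ s ∈ Finset.range (n + 1),
        θ n * (historyLaw π (β n s) t h).toReal := by
    intro h
    have hnn : ∀ n s, 0 ≤ θ n * (historyLaw π (β n s) t h).toReal := fun n s =>
      mul_nonneg (hθ n) ENNReal.toReal_nonneg
    split_ifs with hP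
    · rw [mul_one]
      have h2 : (historyLaw π α t h).toReal ≤
          θ (pulls h i) * (historyLaw π (β (pulls h i) (successes h i)) t h).toReal := by
        have hq := historyLaw_likelihood_update π α i
          (Set.projIcc (0 : ℝ) 1 zero_le_one (empiricalMean h i)) h
        rw [Set.projIcc_of_mem _ (empiricalMean_mem_Icc h i)] at hq
        have hb : β (pulls h i) (successes h i) =
            Function.update α i ⟨empiricalMean h i, empiricalMean_mem_Icc h i⟩ := by
          rw [hβ, ← Set.projIcc_of_mem zero_le_one (empiricalMean_mem_Icc h i)]
          rfl
        rw [← hb] at hq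
        refine le_of_mul_le_mul_right ?_ (likelihood_empiricalMean_pos h i)
        calc _ = _ := hq
          _ ≤ _ := mul_le_mul_of_nonneg_left (H h hP) ENNReal.toReal_nonneg
          _ = _ := by ring
      refine h2.trans ?_
      refine le_trans ?_ (Finset.single_le_sum (f := fun n => ∑ s ∈ Finset.range (n + 1),
        θ n * (historyLaw π (β n s) t h).toReal) (fun n _ => Finset.sum_nonneg fun s _ => hnn n s)
        (Finset.mem_range.2 (Nat.lt_succ_of_le (pulls_le h i))))
      exact Finset.single_le_sum (f := fun s => θ (pulls h i) *
        (historyLaw π (β (pulls h i) s) t h).toReal) (fun s _ => hnn _ s)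
        (Finset.mem_range.2 (Nat.lt_succ_of_le (successes_le_pulls h i)))
    · rw [mul_zero]
      exact Finset.sum_nonneg fun n _ => Finset.sum_nonneg fun s _ => hnn n s
  refine (Finset.sum_le_sum fun h _ => h1 h).trans_eq ?_
  rw [Finset.sum_comm]
  refine Finset.sum_congr rfl fun n _ => ?_
  rw [Finset.sum_comm]
  simp only [← Finset.mul_sum, sum_toReal]
  simp [mul_comm]

section index
variable {t : ℕ} (c : ℝ) (h : History N K t) (i : Fin N)

/-- The exploration budget in round `t + 1`. -/
def budget (t : ℕ) : ℝ := Real.log ((t : ℝ) + 1) + c * Real.log (Real.log ((t : ℝ) + 1))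

lemma klUCB_nonneg : 0 ≤ klUCB c h i := by
  rw [klUCB]
  split_ifs
  · exact zero_le_one
  · exact Real.sSup_nonneg fun x hx => hx.1.1

lemma klUCB_le_one : klUCB c h i ≤ 1 := by
  rw [klUCB]
  split_ifs
  · exact le_rfl
  · exact Real.sSup_le (fun x hx => hx.1.2) zero_le_one

variable {c h i}

lemma le_klUCB {u : ℝ} (hu : u ∈ Set.Icc (0 : ℝ) 1)
    (hk : (pulls h i : ℝ≥0∞) * kl (empiricalMean h i) u ≤ ENNReal.ofReal (budget c t)) :
    u ≤ klUCB c h i := by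
  rw [klUCB]
  split_ifs
  · exact hu.2
  · exact le_csSup ⟨1, fun x hx => hx.1.2⟩ ⟨hu, hk⟩

lemma empiricalMean_le_klUCB : empiricalMean h i ≤ klUCB c h i :=
  le_klUCB (empiricalMean_mem_Icc h i) (by simp [kl_self])

/-- Working with a feasible point above v avoids proving that the supremum is attained. The
hypothesis 0 ≤ v disposes of the default `sSup ∅ = 0`. -/
lemma exists_of_lt_klUCB {v : ℝ} (hv : 0 ≤ v) (hp : pulls h i ≠ 0) (hlt : v < klUCB c h i) :
    ∃ u ∈ Set.Icc (0 : ℝ) 1, v < u ∧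
      (pulls h i : ℝ≥0∞) * kl (empiricalMean h i) u ≤ ENNReal.ofReal (budget c t) := by
  rw [klUCB, if_neg hp] at hlt
  rcases Set.eq_empty_or_nonempty {u : ℝ | u ∈ Set.Icc (0 : ℝ) 1 ∧
    (pulls h i : ℝ≥0∞) * kl (empiricalMean h i) u ≤
      ENNReal.ofReal (Real.log ((t : ℝ) + 1) + c * Real.log (Real.log ((t : ℝ) + 1)))} with he | hne
  · rw [he, Real.sSup_empty] at hlt
    exact absurd hlt hv.not_gt
  · obtain ⟨u, hu, hvu⟩ := exists_lt_of_lt_csSup hne hlt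
    exact ⟨u, hu.1, hvu, hu.2⟩

end index

/-- From t = 2 on, t + 1 ≥ 3 > e, so the iterated logarithm is nonnegative. -/
lemma log_le_budget {c : ℝ} (hc : 0 < c) {t : ℕ} (ht : 2 ≤ t) :
    Real.log ((t : ℝ) + 1) ≤ budget c t := by
  have h3 : Real.exp 1 ≤ (t : ℝ) + 1 := by
    have : (2 : ℝ) ≤ t := by exact_mod_cast ht
    linarith [Real.exp_one_lt_d9]
  have h1 : 1 ≤ Real.log ((t : ℝ) + 1) := by
    rw [Real.le_log_iff_exp_le (by positivity)]
    exact h3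
  have := mul_nonneg hc.le (Real.log_nonneg h1)
  rw [budget]
  linarith

lemma budget_le {c : ℝ} (hc : 0 < c) {t T : ℕ} (ht : t < T) :
    budget c t ≤ (1 + c) * Real.log T := by
  have h0 : 0 ≤ Real.log ((t : ℝ) + 1) :=
    Real.log_nonneg (by linarith [Nat.cast_nonneg (α := ℝ) t])
  have h1 : Real.log ((t : ℝ) + 1) ≤ Real.log T :=
    Real.log_le_log (by positivity) (by exact_mod_cast ht)
  have h2 := Real.log_le_self h0
  rw [budget]
  nlinarith

/-- The index of a source rarely underestimates its reliability by a fixed margin. -/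
lemma exists_prob_klUCB_lt_le {c : ℝ} (hc : 0 < c) (α : Fin N → I) (i : Fin N) {η : ℝ}
    (hη : 0 < η) : ∃ C : ℝ, 0 ≤ C ∧ ∀ (π : Policy N K) (t : ℕ),
      prob π α t (fun h => klUCB c h i < α i - η) ≤ C / ((t : ℝ) + 1) := by
  rcases le_or_gt ((α i : ℝ) - η) 0 with h0 | h0
  · refine ⟨0, le_rfl, fun π t => ?_⟩
    rw [prob_eq_zero π α t fun h hlt => by linarith [klUCB_nonneg c h i]]
    simp
  set u := (α i : ℝ) - η with hu
  have hα1 : (α i : ℝ) ≤ 1 := (α i).2.2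
  have hu01 : u ∈ Set.Ioo (0 : ℝ) 1 := ⟨h0, by linarith⟩
  obtain ⟨ρ, hρ, hρα⟩ := exists_pow_mul_pow_le hu01 (by linarith : u < α i) hα1
  have hsum : Summable fun n : ℕ => ((n : ℝ) + 1) * ρ ^ n := by
    have h1 : ‖ρ‖ < 1 := by rw [Real.norm_of_nonneg hρ.1.le]; exact hρ.2
    have := (summable_pow_mul_geometric_of_norm_lt_one 1 h1).add
      (summable_geometric_of_norm_lt_one h1)
    refine this.congr fun n => by ring
  have hterm : ∀ n : ℕ, 0 ≤ ((n : ℝ) + 1) * ρ ^ n := fun n => by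
    have := hρ.1
    positivity
  -- The summand 2 makes the bound trivial for t < 2, where `log_le_budget` is not available.
  refine ⟨2 + ∑' n : ℕ, ((n : ℝ) + 1) * ρ ^ n, add_nonneg zero_le_two (tsum_nonneg hterm),
    fun π t => ?_⟩
  have ht1 : (0 : ℝ) < (t : ℝ) + 1 := by positivity
  rcases lt_or_ge t 2 with ht | ht
  · refine (prob_le_one _ _ _ _).trans ?_
    rw [le_div_iff₀ ht1]
    have : (t : ℝ) ≤ 1 := by exact_mod_cast (by omega : t ≤ 1)
    linarith [tsum_nonneg (L := SummationFilter.unconditional ℕ) hterm]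
  refine (prob_le_of_likelihood_le π α t i _ (fun n => ρ ^ n / ((t : ℝ) + 1))
    (fun n => div_nonneg (pow_nonneg hρ.1.le n) ht1.le) ?_).trans ?_
  · intro h hlt
    have hp : pulls h i ≠ 0 := by
      intro hp
      rw [klUCB, if_pos hp] at hlt
      linarith
    have hp' : (0 : ℝ) < pulls h i := by positivity
    have hm : empiricalMean h i < u := empiricalMean_le_klUCB.trans_lt hlt
    -- Otherwise u itself would be feasible and the index could not lie below it.
    have hk : Real.log ((t : ℝ) + 1) < pulls h i * klReal (empiricalMean h i) u := by
      by_contra! hcon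
      refine hlt.not_ge (le_klUCB (Set.Ioo_subset_Icc_self hu01) ?_)
      rw [kl_eq_ofReal hu01.1.ne' hu01.2.ne, ← ENNReal.ofReal_natCast,
        ← ENNReal.ofReal_mul hp'.le]
      exact ENNReal.ofReal_le_ofReal (hcon.trans (log_le_budget hc ht))
    have h1 := hρα _ _ (successes_le_pulls h i) (by
      rw [empiricalMean, div_lt_iff₀ hp'] at hm
      linarith)
    have h2 := pow_mul_pow_le_exp_klReal hu01 (successes_le_pulls h i) hp
    have h3 : Real.exp (-(pulls h i * klReal (empiricalMean h i) u)) ≤ 1 / ((t : ℝ) + 1) := by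
      rw [one_div, ← Real.exp_log (inv_pos.2 ht1), Real.log_inv]
      exact Real.exp_le_exp.2 (by linarith)
    have h4 := (likelihood_empiricalMean_pos h i).le
    calc likelihood i (α i) h ≤ _ := h1
      _ ≤ ρ ^ pulls h i * (1 / ((t : ℝ) + 1) * likelihood i (empiricalMean h i) h) :=
        mul_le_mul_of_nonneg_left (h2.trans (mul_le_mul_of_nonneg_right h3 h4))
          (pow_nonneg hρ.1.le _)
      _ = _ := by ring
  · simp only [mul_div_assoc', ← Finset.sum_div]
    refine div_le_div_of_nonneg_right ?_ ht1.le
    have := hsum.sum_le_tsum (Finset.range (t + 1)) (fun n _ => hterm n)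
    linarith

/-- The index of a source that was selected often rarely overestimates its reliability by a fixed
margin. -/
lemma exists_prob_lt_klUCB_le {c : ℝ} (hc : 0 < c) (α : Fin N → I) (i : Fin N) {η : ℝ}
    (hη : 0 < η) : ∃ C : ℝ, 0 ≤ C ∧ ∀ (π : Policy N K) (T t L : ℕ), 2 ≤ T → t < T →
      C * Real.log T ≤ L →
      prob π α t (fun h => L ≤ pulls h i ∧ α i + η < klUCB c h i) ≤ 1 / (T : ℝ) := by
  have hα0 : (0 : ℝ) ≤ α i := (α i).2.1
  rcases le_or_gt 1 ((α i : ℝ) + η) with h1 | h1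
  · refine ⟨0, le_rfl, fun π T t L _ _ _ => ?_⟩
    rw [prob_eq_zero π α t fun h hlt => by linarith [klUCB_le_one c h i, hlt.2]]
    positivity
  set v := (α i : ℝ) + η / 2 with hv
  have hv01 : v ∈ Set.Ioo (0 : ℝ) 1 := ⟨by linarith, by linarith⟩
  obtain ⟨ρ, hρ, hρα⟩ := exists_pow_mul_pow_le' hv01 (by linarith : (α i : ℝ) < v) hα0
  have hlρ : 0 < -Real.log ρ := neg_pos.2 (Real.log_neg hρ.1 hρ.2)
  have hC0 : 0 < 16 * (1 + c) / η ^ 2 := by positivity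
  have hC1 : 0 < 3 / -Real.log ρ := by positivity
  -- The first term makes n η²/16 reach the bound (1 + c) log T on the budget, the 1 makes it exceed
  -- that bound strictly, and the last term forces ρ ^ L ≤ T^(-3).
  refine ⟨16 * (1 + c) / η ^ 2 + 1 + 3 / -Real.log ρ, by positivity,
    fun π T t L hT ht hL => ?_⟩
  have hT0 : (0 : ℝ) < T := by positivity
  have hlT : 0 < Real.log T := Real.log_pos (by exact_mod_cast hT)
  have hρL : ρ ^ L ≤ 1 / (T : ℝ) ^ 3 := by
    rw [← Real.log_le_log_iff (pow_pos hρ.1 _) (by positivity), Real.log_pow, one_div, Real.log_inv,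
      Real.log_pow]
    have h2 : 3 / -Real.log ρ * Real.log T ≤ L := by nlinarith
    have h3 := mul_le_mul_of_nonneg_right h2 hlρ.le
    have h4 : 3 / -Real.log ρ * Real.log T * -Real.log ρ = 3 * Real.log T := by
      rw [div_mul_eq_mul_div, div_mul_cancel₀ _ hlρ.ne']
    push_cast
    linarith
  refine (prob_le_of_likelihood_le π α t i _ (fun n => if L ≤ n then ρ ^ n else 0)
    (fun n => by
      split_ifs
      · exact pow_nonneg hρ.1.le n
      · exact le_rfl) ?_).trans ?_
  · rintro h ⟨hLp, hlt⟩
    rw [if_pos hLp]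
    have hL0 : (0 : ℝ) < L := lt_of_lt_of_le (by positivity) hL
    have hp : pulls h i ≠ 0 := by
      have : 0 < L := by exact_mod_cast hL0
      omega
    have hp' : (0 : ℝ) < pulls h i := by positivity
    -- A mean below v would be at distance at least η/2 from a feasible u, and by Pinsker so many
    -- selections exceed the budget. Thus overestimation comes from a large deviation of the mean.
    have hm : v ≤ empiricalMean h i := by
      by_contra! hcon
      obtain ⟨u, hu, hvu, hk⟩ := exists_of_lt_klUCB (by linarith) hp hlt
      have h2 := (mul_le_mul_right (ofReal_sq_sub_le_kl (empiricalMean_mem_Icc h i) hu)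
        (pulls h i : ℝ≥0∞)).trans hk
      rw [← ENNReal.ofReal_natCast, ← ENNReal.ofReal_mul hp'.le] at h2
      have h3 : η ^ 2 / 16 ≤ (empiricalMean h i - u) ^ 2 / 4 := by nlinarith
      have h4 : pulls h i * (η ^ 2 / 16) ≤ (1 + c) * Real.log T := by
        have h5 := h2.trans (ENNReal.ofReal_le_ofReal (budget_le hc ht))
        rw [ENNReal.ofReal_le_ofReal_iff (by positivity)] at h5
        exact (mul_le_mul_of_nonneg_left h3 hp'.le).trans h5
      have h5 : (16 * (1 + c) / η ^ 2 + 1) * Real.log T ≤ pulls h i := by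
        have : (L : ℝ) ≤ pulls h i := by exact_mod_cast hLp
        nlinarith [mul_pos hC1 hlT]
      have h6 := mul_le_mul_of_nonneg_right h5 (by positivity : 0 ≤ η ^ 2 / 16)
      have h7 : (16 * (1 + c) / η ^ 2 + 1) * Real.log T * (η ^ 2 / 16) =
          (1 + c) * Real.log T + Real.log T * (η ^ 2 / 16) := by
        field_simp
      have h8 : 0 < Real.log T * (η ^ 2 / 16) := by positivity
      linarith
    have h1 := hρα _ _ (successes_le_pulls h i) (by
      rw [empiricalMean, le_div_iff₀ hp'] at hm
      linarith)
    refine h1.trans (mul_le_mul_of_nonneg_left ?_ (pow_nonneg hρ.1.le _))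
    refine (pow_mul_pow_le_exp_klReal hv01 (successes_le_pulls h i) hp).trans ?_
    refine mul_le_of_le_one_left (likelihood_empiricalMean_pos h i).le ?_
    rw [Real.exp_le_one_iff, neg_nonpos]
    exact mul_nonneg hp'.le (le_trans (by positivity) (sq_sub_div_four_le_klReal
      (empiricalMean_mem_Icc h i) (Set.Ioo_subset_Icc_self hv01)
      (fun h0 => absurd h0 hv01.1.ne') (fun h0 => absurd h0 hv01.2.ne)))
  -- There are at most T values of n, each with weight at most T; the cube in T^(-3) leaves 1/T.
  · have hb : ∀ n ∈ Finset.range (t + 1),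
        ((n : ℝ) + 1) * (if L ≤ n then ρ ^ n else 0) ≤ T * (1 / (T : ℝ) ^ 3) := by
      intro n hn
      have hn1 : (n : ℝ) + 1 ≤ T := by
        have : n + 1 ≤ T := by
          have := Finset.mem_range.1 hn
          omega
        exact_mod_cast this
      refine mul_le_mul hn1 ?_ ?_ hT0.le
      · split_ifs with hLn
        · exact (pow_le_pow_of_le_one hρ.1.le hρ.2.le hLn).trans hρL
        · positivity
      · split_ifs
        · exact pow_nonneg hρ.1.le n
        · exact le_rfl
    refine (Finset.sum_le_sum hb).trans ?_
    rw [Finset.sum_const, Finset.card_range, nsmul_eq_mul]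
    have : ((t + 1 : ℕ) : ℝ) ≤ T := by exact_mod_cast ht
    refine (mul_le_mul_of_nonneg_right this (by positivity)).trans_eq ?_
    field_simp

end

/-! ### Logarithmic regret of the algorithm. -/

noncomputable section

variable {N K : ℕ} (G : Matrix (Fin N) (Fin N) ℝ) {ε : ℝ} (α : Fin N → I)

lemma scale_pos (hε : 0 < ε) : 0 < scale ε :=
  mul_pos two_pos (Real.log_pos ((one_lt_div hε).2 (by linarith)))

lemma reliabilityReward_eq (hε : 0 < ε) (a : ℝ) :
    reliabilityReward ε a = scale ε * a + 2 * Real.log ε := by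
  rw [reliabilityReward, scale, Real.log_div (by positivity) hε.ne']
  ring

/-- The suboptimality gap of an action. -/
def gap (ε : ℝ) (S : Action N K) : ℝ :=
  optValue K G ε (fun i => (α i : ℝ)) - objective G ε (fun i => (α i : ℝ)) S.1

lemma gap_nonneg (ε : ℝ) (S : Action N K) : 0 ≤ gap G α ε S :=
  sub_nonneg.2 (le_ciSup (f := fun S : Action N K => objective G ε (fun i => (α i : ℝ)) S.1)
    (Set.finite_range _).bddAbove S)

lemma regret_nonneg (ε : ℝ) {T : ℕ} (h : History N K T) : 0 ≤ regret G ε α h :=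
  Finset.sum_nonneg fun t _ => gap_nonneg G α ε (h t).1

lemma expectedRegret_nonneg (ε : ℝ) (π : Policy N K) (T : ℕ) :
    0 ≤ expectedRegret G ε π α T :=
  expect_nonneg π α T fun h => regret_nonneg G α ε h

/-- The expected sum of a function of the past and the current action. -/
lemma expect_eq_sum_of_extend (π : Policy N K) {φ : (t : ℕ) → History N K t → ℝ}
    {ψ : (t : ℕ) → History N K t → Action N K → ℝ} (h0 : φ 0 Fin.elim0 = 0)
    (h : ∀ t x S z, φ (t + 1) (extend x S z) = φ t x + ψ t x S) (T : ℕ) :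
    expect π α T (φ T) =
      ∑ t ∈ Finset.range T, expect π α t fun x => ∑ S, (π t x S).toReal * ψ t x S := by
  induction T with
  | zero => simp [expect_zero, h0]
  | succ T ih => rw [Finset.sum_range_succ, ← ih, expect_succ_of_extend π α T (h T)]

lemma expectedRegret_eq_sum (ε : ℝ) (π : Policy N K) (T : ℕ) :
    expectedRegret G ε π α T = ∑ t ∈ Finset.range T,
      expect π α t fun x => ∑ S, (π t x S).toReal * gap G α ε S :=
  expect_eq_sum_of_extend α π (φ := fun _ => regret G ε α) (by simp [regret])
    (fun _ x S z => regret_extend G ε α x S z) T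

lemma objective_le_add (hε : 0 < ε) {a b : Fin N → ℝ} {S : Finset (Fin N)} {δ : ℝ}
    (h : ∀ i ∈ S, a i ≤ b i + δ) :
    objective G ε a S ≤ objective G ε b S + scale ε * (S.card * δ) := by
  have : ∑ i ∈ S, reliabilityReward ε (a i) ≤
      ∑ i ∈ S, (reliabilityReward ε (b i) + scale ε * δ) := by
    refine Finset.sum_le_sum fun i hi => ?_
    rw [reliabilityReward_eq hε, reliabilityReward_eq hε]
    nlinarith [mul_le_mul_of_nonneg_left (h i hi) (scale_pos hε).le]
  rw [Finset.sum_add_distrib, Finset.sum_const, nsmul_eq_mul] at this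
  rw [objective, objective]
  linarith

lemma exists_margin (ε : ℝ) :
    ∃ η > 0, ∀ S : Action N K, 0 < gap G α ε S → scale ε * (2 * (K * η)) < gap G α ε S := by
  have h : ∀ S : Action N K, ∀ᶠ η in 𝓝[>] (0 : ℝ),
      0 < gap G α ε S → scale ε * (2 * (K * η)) < gap G α ε S := by
    intro S
    by_cases hS : 0 < gap G α ε S
    · have ht : Tendsto (fun η : ℝ => scale ε * (2 * (K * η))) (𝓝[>] 0) (𝓝 0) := by
        have : Continuous fun η : ℝ => scale ε * (2 * (K * η)) := by fun_prop
        exact (this.tendsto' 0 0 (by simp)).mono_left nhdsWithin_le_nhds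
      filter_upwards [ht.eventually_lt_const hS] with η hη _ using hη
    · exact Eventually.of_forall fun η h => absurd h hS
  obtain ⟨η, hη, hpos⟩ := ((eventually_all.2 h).and self_mem_nhdsWithin).exists
  exact ⟨η, hpos, hη⟩

open Classical in
/-- An action chosen by the algorithm is optimal unless some index underestimates its source or
the index of a selected source overestimates it. -/
lemma gap_le_of_isProbDPP (hε : 0 < ε) {c : ℝ} {π : Policy N K} (hπ : IsProbDPP G ε c π)
    {η R : ℝ} (hη : ∀ S : Action N K, 0 < gap G α ε S → scale ε * (2 * (K * η)) < gap G α ε S)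
    (hR : ∀ S : Action N K, gap G α ε S ≤ R) {t : ℕ} (h : History N K t) {S : Action N K}
    (hS : S ∈ (π t h).support) :
    gap G α ε S ≤ R * ∑ i, ((if klUCB c h i < α i - η then 1 else 0) +
      if i ∈ S.1 ∧ α i + η < klUCB c h i then 1 else 0) := by
  have hR0 : 0 ≤ R := (gap_nonneg G α ε S).trans (hR S)
  have hnn : ∀ i, (0 : ℝ) ≤ (if klUCB c h i < α i - η then 1 else 0) +
      if i ∈ S.1 ∧ α i + η < klUCB c h i then 1 else 0 := fun i => by
    split_ifs <;> norm_num
  by_cases hbad : ∃ i, klUCB c h i < α i - η ∨ i ∈ S.1 ∧ α i + η < klUCB c h i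
  · obtain ⟨i, hi⟩ := hbad
    refine (hR S).trans (le_mul_of_one_le_right hR0 ?_)
    refine le_trans ?_ (Finset.single_le_sum (fun j _ => hnn j) (Finset.mem_univ i))
    rcases hi with hi | hi
    · rw [if_pos hi]
      split_ifs <;> norm_num
    · rw [if_pos hi]
      split_ifs <;> norm_num
  · push Not at hbad
    refine le_trans ?_ (mul_nonneg hR0 (Finset.sum_nonneg fun i _ => hnn i))
    by_contra! hpos
    -- With all relevant indices accurate, passing from an optimal S₀ to S through the optimistic
    -- objective loses at most K η β_ε on each side, contrary to the margin.
    have : Nonempty (Action N K) := ⟨S⟩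
    obtain ⟨S₀, h₀⟩ := exists_eq_ciSup_of_finite
      (f := fun S : Action N K => objective G ε (fun i => (α i : ℝ)) S.1)
    have h1 : objective G ε (fun i => (α i : ℝ)) S₀.1 ≤
        objective G ε (klUCB c h) S₀.1 + scale ε * (S₀.1.card * η) :=
      objective_le_add G hε fun i _ => by linarith [(hbad i).1]
    have h2 := hπ t h S hS S₀
    have h3 : objective G ε (klUCB c h) S.1 ≤
        objective G ε (fun i => (α i : ℝ)) S.1 + scale ε * (S.1.card * η) :=
      objective_le_add G hε fun i hi => (hbad i).2 hi
    rw [S₀.2] at h1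
    rw [S.2] at h3
    have h4 := hη S hpos
    have h5 : gap G α ε S = objective G ε (fun i => (α i : ℝ)) S₀.1 -
        objective G ε (fun i => (α i : ℝ)) S.1 := by
      rw [gap, optValue, ← h₀]
    linarith

open Classical in
/-- A source is selected at most `L` times while it has been selected less than `L` times. -/
lemma sum_expect_mem_and_pulls_lt_le (π : Policy N K) (i : Fin N) (L T : ℕ) :
    ∑ t ∈ Finset.range T, expect π α t (fun x => ∑ S, (π t x S).toReal *
      if i ∈ S.1 ∧ pulls x i < L then 1 else 0) ≤ L := by
  -- The sum telescopes to the expectation of min(N_i, L), which grows exactly in the rounds counted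
  -- here.
  rw [← expect_eq_sum_of_extend α π (φ := fun t x => ((min (pulls x i) L : ℕ) : ℝ))
    (ψ := fun t x S => if i ∈ S.1 ∧ pulls x i < L then 1 else 0)]
  · refine (expect_mono π α T fun x => ?_).trans_eq (expect_const π α T (L : ℝ))
    exact_mod_cast min_le_right _ _
  · simp [pulls]
  · intro t x S z
    rw [pulls_extend]
    have : min (pulls x i + if i ∈ S.1 then 1 else 0) L =
        min (pulls x i) L + if i ∈ S.1 ∧ pulls x i < L then 1 else 0 := by
      by_cases h1 : i ∈ S.1 <;> by_cases h2 : pulls x i < L <;> simp [h1, h2] <;> omega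
    rw [this]
    push_cast
    rfl

lemma sum_one_div_le (T : ℕ) :
    ∑ t ∈ Finset.range T, 1 / ((t : ℝ) + 1) ≤ 1 + Real.log T := by
  have h := harmonic_le_one_add_log T
  rw [harmonic] at h
  push_cast at h
  simpa using h

open Classical in
-- An overestimated selection of i either occurs among its first L ≈ C₂ log T selections or falls
-- under the 1/T tail bound. Underestimation sums harmonically. For T ≥ 3, log T ≥ 1 absorbs the
-- additive constants.
lemma exists_sum_expect_le_log {c : ℝ} (hc : 0 < c) (i : Fin N) {η : ℝ} (hη : 0 < η) :
    ∃ M : ℝ, ∀ (π : Policy N K) (T : ℕ), 3 ≤ T →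
      ∑ t ∈ Finset.range T, expect π α t (fun x => ∑ S, (π t x S).toReal *
        ((if klUCB c x i < α i - η then 1 else 0) +
          if i ∈ S.1 ∧ α i + η < klUCB c x i then 1 else 0)) ≤ M * Real.log T := by
  obtain ⟨C₁, hC₁, h₁⟩ := exists_prob_klUCB_lt_le (K := K) hc α i hη
  obtain ⟨C₂, hC₂, h₂⟩ := exists_prob_lt_klUCB_le (K := K) hc α i hη
  refine ⟨2 * C₁ + C₂ + 2, fun π T hT => ?_⟩
  have hT0 : (0 : ℝ) < T := by positivity
  have hlog : 1 ≤ Real.log T := by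
    rw [Real.le_log_iff_exp_le hT0]
    have : (3 : ℝ) ≤ T := by exact_mod_cast hT
    linarith [Real.exp_one_lt_d9]
  set L := ⌈C₂ * Real.log T⌉₊ with hL
  have hL1 : C₂ * Real.log T ≤ L := Nat.le_ceil _
  have hL2 : (L : ℝ) < C₂ * Real.log T + 1 := Nat.ceil_lt_add_one (by positivity)
  have hterm : ∀ t ∈ Finset.range T, expect π α t (fun x => ∑ S, (π t x S).toReal *
        ((if klUCB c x i < α i - η then 1 else 0) +
          if i ∈ S.1 ∧ α i + η < klUCB c x i then 1 else 0)) ≤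
      C₁ * (1 / ((t : ℝ) + 1)) + 1 / (T : ℝ) + expect π α t (fun x => ∑ S, (π t x S).toReal *
        if i ∈ S.1 ∧ pulls x i < L then 1 else 0) := by
    intro t ht
    have hp₁ := h₁ π t
    have hp₂ := h₂ π T t L (by omega) (Finset.mem_range.1 ht) hL1
    rw [div_eq_mul_one_div] at hp₁
    refine le_trans ?_ (add_le_add_left (add_le_add hp₁ hp₂) _)
    rw [prob, prob, ← expect_add, ← expect_add]
    refine expect_mono π α t fun x => ?_
    have : ∀ a : ℝ, a = ∑ S, (π t x S).toReal * a := fun a => by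
      rw [← Finset.sum_mul, sum_toReal, one_mul]
    refine le_trans ?_ (add_le_add_left (this _).ge _)
    rw [← Finset.sum_add_distrib]
    refine Finset.sum_le_sum fun S _ => ?_
    rw [← mul_add]
    refine mul_le_mul_of_nonneg_left ?_ ENNReal.toReal_nonneg
    rw [add_assoc]
    refine add_le_add_right ?_ _
    by_cases h1 : i ∈ S.1 <;> by_cases h2 : α i + η < klUCB c x i <;>
      rcases lt_or_ge (pulls x i) L with h3 | h3 <;>
      simp [h1, h2, h3, not_le_of_gt, not_lt_of_ge]
  refine (Finset.sum_le_sum hterm).trans ?_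
  rw [Finset.sum_add_distrib, Finset.sum_add_distrib, ← Finset.mul_sum, Finset.sum_const,
    Finset.card_range, nsmul_eq_mul, mul_one_div_cancel hT0.ne']
  have h3 := sum_expect_mem_and_pulls_lt_le α π i L T
  have h4 := mul_le_mul_of_nonneg_left (sum_one_div_le T) hC₁
  nlinarith

/-- The algorithm has logarithmic expected regret. -/
theorem expectedRegret_isBigO_log (hε : 0 < ε) {c : ℝ} (hc : 0 < c) {π : Policy N K}
    (hπ : IsProbDPP G ε c π) :
    (fun T : ℕ => expectedRegret G ε π α T) =O[atTop] (fun T : ℕ => Real.log T) := by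
  classical
  obtain ⟨η, hη0, hη⟩ := exists_margin (K := K) G α ε
  obtain ⟨R, hR⟩ := (Set.finite_range fun S : Action N K => gap G α ε S).bddAbove
  -- The maximum with 0 supplies a sign that an arbitrary upper bound of a possibly empty range
  -- lacks.
  have hR' : ∀ S : Action N K, gap G α ε S ≤ max R 0 := fun S =>
    (hR ⟨S, rfl⟩).trans (le_max_left _ _)
  choose M hM using fun i => exists_sum_expect_le_log (K := K) α hc i hη0
  refine IsBigO.of_bound (max R 0 * ∑ i, M i) ?_
  filter_upwards [eventually_ge_atTop 3] with T hT
  have hT0 : (1 : ℝ) ≤ T := by exact_mod_cast (by omega : 1 ≤ T)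
  rw [Real.norm_of_nonneg (expectedRegret_nonneg G α ε π T),
    Real.norm_of_nonneg (Real.log_nonneg hT0), expectedRegret_eq_sum]
  have hterm : ∀ t ∈ Finset.range T,
      expect π α t (fun x => ∑ S, (π t x S).toReal * gap G α ε S) ≤
      max R 0 * ∑ i, expect π α t (fun x => ∑ S, (π t x S).toReal *
        ((if klUCB c x i < α i - η then 1 else 0) +
          if i ∈ S.1 ∧ α i + η < klUCB c x i then 1 else 0)) := by
    intro t _
    rw [← expect_sum, ← expect_const_mul]
    refine expect_mono π α t fun x => ?_
    rw [Finset.sum_comm, Finset.mul_sum]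
    refine Finset.sum_le_sum fun S _ => ?_
    rw [← Finset.mul_sum]
    by_cases hS : S ∈ (π t x).support
    · have := mul_le_mul_of_nonneg_left (gap_le_of_isProbDPP G α hε hπ hη hR' x hS)
        (ENNReal.toReal_nonneg (a := π t x S))
      linarith
    · rw [PMF.mem_support_iff, not_not] at hS
      simp [hS]
  refine (Finset.sum_le_sum hterm).trans ?_
  rw [← Finset.mul_sum, Finset.sum_comm, mul_assoc, Finset.sum_mul]
  exact mul_le_mul_of_nonneg_left (Finset.sum_le_sum fun i _ => hM i π T hT) (le_max_right _ _)

end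

/-! ### Log-likelihood ratios and the Bretagnolle-Huber inequality. -/

noncomputable section

variable {N K : ℕ}

lemma exp_expect_le (π : Policy N K) (α : Fin N → I) (t : ℕ) (φ : History N K t → ℝ) :
    Real.exp (expect π α t φ) ≤ expect π α t (fun h => Real.exp (φ h)) :=
  convexOn_exp.map_sum_le (w := fun h => (historyLaw π α t h).toReal) (p := φ)
    (fun _ _ => ENNReal.toReal_nonneg) (sum_toReal _) (fun _ _ => Set.mem_univ _)

/-- The log-likelihood ratio of the observations of source `i` for the reliabilities `a` and
`q`. -/
def logRatio {t : ℕ} (i : Fin N) (a q : ℝ) (h : History N K t) : ℝ :=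
  successes h i * Real.log (a / q) +
    ((pulls h i : ℝ) - successes h i) * Real.log ((1 - a) / (1 - q))

/-- Equality holds for x > 0. At x = 0 the logarithm takes its default value and only the inequality
survives, which is the direction that the lower bound needs. -/
lemma pow_mul_exp_le {x y : ℝ} (hx : 0 ≤ x) (hy : 0 < y) (k : ℕ) :
    x ^ k * Real.exp (-(k * Real.log (x / y))) ≤ y ^ k := by
  rcases hx.eq_or_lt with rfl | hx
  · rcases Nat.eq_zero_or_pos k with rfl | hk
    · simp
    · rw [zero_pow hk.ne', zero_mul]
      positivity
  · rw [Real.exp_neg, Real.exp_nat_mul, Real.exp_log (by positivity), div_pow]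
    refine le_of_eq ?_
    field_simp

lemma likelihood_mul_exp_neg_logRatio_le {t : ℕ} (i : Fin N) {a q : ℝ}
    (ha : a ∈ Set.Icc (0 : ℝ) 1) (hq : q ∈ Set.Ioo (0 : ℝ) 1) (h : History N K t) :
    likelihood i a h * Real.exp (-logRatio i a q h) ≤ likelihood i q h := by
  have h1 := pow_mul_exp_le ha.1 hq.1 (successes h i)
  have h2 := pow_mul_exp_le (sub_nonneg.2 ha.2) (sub_pos.2 hq.2) (pulls h i - successes h i)
  rw [Nat.cast_sub (successes_le_pulls h i)] at h2
  rw [likelihood, likelihood, logRatio, neg_add, Real.exp_add]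
  have h3 := mul_le_mul h1 h2
    (mul_nonneg (pow_nonneg (sub_nonneg.2 ha.2) _) (Real.exp_nonneg _)) (pow_nonneg hq.1.le _)
  refine le_trans (le_of_eq ?_) h3
  ring

lemma historyLaw_mul_exp_neg_logRatio_le (π : Policy N K) (α : Fin N → I) (i : Fin N) (q : I)
    (hq : (q : ℝ) ∈ Set.Ioo (0 : ℝ) 1) {t : ℕ} (h : History N K t) :
    (historyLaw π α t h).toReal * Real.exp (-logRatio i (α i) q h) ≤
      (historyLaw π (Function.update α i q) t h).toReal := by
  have hpos : 0 < likelihood i q h :=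
    mul_pos (pow_pos hq.1 _) (pow_pos (sub_pos.2 hq.2) _)
  have h1 := historyLaw_likelihood_update π α i q h
  have h2 := mul_le_mul_of_nonneg_left (likelihood_mul_exp_neg_logRatio_le i (α i).2 hq h)
    (ENNReal.toReal_nonneg (a := historyLaw π (Function.update α i q) t h))
  refine le_of_mul_le_mul_right ?_ hpos
  calc _ = ((historyLaw π α t h).toReal * likelihood i q h) *
        Real.exp (-logRatio i (α i) q h) := by ring
    _ ≤ _ := by rw [h1, mul_assoc]; exact h2

/-- Wald's identity: the ratio is linear in the two counts, and the successes are unbiased given the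
selections. For q in (0, 1) this is the divergence between the two history laws. -/
lemma expect_logRatio (π : Policy N K) (α : Fin N → I) (i : Fin N) (q : ℝ) (t : ℕ) :
    expect π α t (logRatio i (α i) q) =
      expect π α t (fun h => (pulls h i : ℝ)) * klReal (α i) q := by
  have h1 : (logRatio i (α i) q : History N K t → ℝ) = fun h =>
      (Real.log (α i / q) - Real.log ((1 - α i) / (1 - q))) * (successes h i : ℝ) +
        Real.log ((1 - α i) / (1 - q)) * (pulls h i : ℝ) := by
    funext h
    rw [logRatio]
    ring
  rw [h1, expect_add, expect_const_mul, expect_const_mul, expect_successes, klReal]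
  ring

open Classical in
-- Under the change of measure the integrand is at most √P √Q pointwise, where P and Q are the two
-- history laws; Cauchy-Schwarz on A finishes.
lemma expect_exp_neg_half_logRatio_le (π : Policy N K) (α : Fin N → I) (i : Fin N) (q : I)
    (hq : (q : ℝ) ∈ Set.Ioo (0 : ℝ) 1) (t : ℕ) (A : History N K t → Prop) :
    expect π α t (fun h => Real.exp (-logRatio i (α i) q h / 2) * if A h then 1 else 0) ≤
      √(prob π α t A) * √(prob π (Function.update α i q) t A) := by
  set P : History N K t → ℝ := fun h => (historyLaw π α t h).toReal with hP
  set Q : History N K t → ℝ := fun h => (historyLaw π (Function.update α i q) t h).toReal with hQ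
  have hP0 : ∀ h, 0 ≤ P h := fun h => ENNReal.toReal_nonneg
  have hQ0 : ∀ h, 0 ≤ Q h := fun h => ENNReal.toReal_nonneg
  have hA0 : ∀ h, (0 : ℝ) ≤ if A h then 1 else 0 := fun h => by split_ifs <;> norm_num
  refine le_trans (Finset.sum_le_sum fun h _ => ?_) (Real.sum_sqrt_mul_sqrt_le Finset.univ
    (f := fun h => P h * if A h then 1 else 0) (g := fun h => Q h * if A h then 1 else 0)
    (fun h => mul_nonneg (hP0 h) (hA0 h)) (fun h => mul_nonneg (hQ0 h) (hA0 h)))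
  beta_reduce
  split_ifs with hA
  · rw [mul_one, mul_one, mul_one]
    calc P h * Real.exp (-logRatio i (α i) q h / 2)
        = √(P h) * √(P h * Real.exp (-logRatio i (α i) q h)) := by
          rw [Real.sqrt_mul (hP0 h), ← mul_assoc, Real.mul_self_sqrt (hP0 h), Real.exp_half]
      _ ≤ √(P h) * √(Q h) := mul_le_mul_of_nonneg_left
          (Real.sqrt_le_sqrt (historyLaw_mul_exp_neg_logRatio_le π α i q hq h))
          (Real.sqrt_nonneg _)
  · simp

/-- The Bretagnolle-Huber inequality for two instances that differ in source `i` only. -/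
lemma exp_neg_half_le_sqrt_add_sqrt (π : Policy N K) (α : Fin N → I) (i : Fin N) (q : I)
    (hq : (q : ℝ) ∈ Set.Ioo (0 : ℝ) 1) (t : ℕ) (A : History N K t → Prop) :
    Real.exp (-(expect π α t (fun h => (pulls h i : ℝ)) * klReal (α i) q) / 2) ≤
      √(prob π α t A) + √(prob π (Function.update α i q) t fun h => ¬ A h) := by
  classical
  -- Jensen for exp at minus half the log-ratio; the expectation is then split over A and its
  -- complement, keeping one square root on each.
  have h1 := exp_expect_le π α t fun h => (-1 / 2) * logRatio i (α i) q h
  rw [expect_const_mul, expect_logRatio] at h1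
  have h2 : (fun h : History N K t => Real.exp ((-1 / 2) * logRatio i (α i) q h)) = fun h =>
      (Real.exp (-logRatio i (α i) q h / 2) * if A h then 1 else 0) +
        Real.exp (-logRatio i (α i) q h / 2) * if ¬ A h then 1 else 0 := by
    funext h
    have : (-1 / 2) * logRatio i (α i) q h = -logRatio i (α i) q h / 2 := by ring
    by_cases hA : A h <;> simp [hA, this]
  rw [h2, expect_add] at h1
  have hsq : ∀ (β : Fin N → I) (B : History N K t → Prop), √(prob π β t B) ≤ 1 := fun β B =>
    Real.sqrt_le_one.2 (prob_le_one π β t B)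
  have h3 := (expect_exp_neg_half_logRatio_le π α i q hq t A).trans
    (mul_le_of_le_one_right (Real.sqrt_nonneg _) (hsq _ _))
  have h4 := (expect_exp_neg_half_logRatio_le π α i q hq t fun h => ¬ A h).trans
    (mul_le_of_le_one_left (Real.sqrt_nonneg _) (hsq _ _))
  have h5 : -(expect π α t (fun h => (pulls h i : ℝ)) * klReal (α i) q) / 2 =
      (-1 / 2) * (expect π α t (fun h => (pulls h i : ℝ)) * klReal (α i) q) := by ring
  rw [h5]
  refine h1.trans (add_le_add h3 ?_)
  convert h4

/-! ### The lower bound on the restricted instance. -/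

section restricted
variable {G : Matrix (Fin N) (Fin N) ℝ} {ε : ℝ}

lemma gap_of_isRestricted (hε : 0 < ε) (hG : IsRestricted G) {α : Fin N → I} {iStar : Fin N}
    (hmax : ∀ i, α i ≤ α iStar) (S : Action N 1) :
    gap G α ε S = ∑ i, scale ε * ((α iStar : ℝ) - α i) * if i ∈ S.1 then 1 else 0 := by
  have hobj : ∀ i, objective G ε (fun i => (α i : ℝ)) {i} =
      diversity G {iStar} + scale ε * α i + 2 * Real.log ε := fun i => by
    rw [objective, Finset.sum_singleton, reliabilityReward_eq hε, hG.diversity_const i iStar]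
    ring
  have hopt : optValue 1 G ε (fun i => (α i : ℝ)) =
      objective G ε (fun i => (α i : ℝ)) {iStar} := by
    have : Nonempty (Action N 1) := ⟨S⟩
    refine le_antisymm (ciSup_le fun S' => ?_) (le_ciSup
      (f := fun S : Action N 1 => objective G ε (fun i => (α i : ℝ)) S.1)
      (Set.finite_range _).bddAbove ⟨{iStar}, Finset.card_singleton _⟩)
    obtain ⟨j, hj⟩ := Finset.card_eq_one.1 S'.2
    have : (α j : ℝ) ≤ α iStar := hmax j
    rw [hj, hobj, hobj]
    nlinarith [mul_le_mul_of_nonneg_left this (scale_pos hε).le]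
  obtain ⟨j, hj⟩ := Finset.card_eq_one.1 S.2
  rw [gap, hopt, hj, hobj, hobj]
  simp only [Finset.mem_singleton, mul_ite, mul_one, mul_zero]
  rw [Finset.sum_ite_eq' Finset.univ j, if_pos (Finset.mem_univ j)]
  ring

lemma expectedRegret_of_isRestricted (hε : 0 < ε) (hG : IsRestricted G) (π : Policy N 1)
    {α : Fin N → I} {iStar : Fin N} (hmax : ∀ i, α i ≤ α iStar) (T : ℕ) :
    expectedRegret G ε π α T =
      ∑ i, scale ε * ((α iStar : ℝ) - α i) * expect π α T (fun h => (pulls h i : ℝ)) := by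
  rw [expectedRegret_eq]
  simp only [← expect_const_mul, ← expect_sum]
  congr 1
  funext h
  have : regret G ε α h = ∑ t, gap G α ε (h t).1 := rfl
  simp only [this, gap_of_isRestricted hε hG hmax]
  rw [Finset.sum_comm]
  refine Finset.sum_congr rfl fun i _ => ?_
  rw [← Finset.mul_sum, pulls_eq_sum]
  push_cast
  rfl

lemma sum_pulls {t : ℕ} (h : History N K t) : ∑ i, pulls h i = t * K := by
  simp only [pulls_eq_sum]
  rw [Finset.sum_comm]
  simp [(h _).1.2]

lemma prob_lt_two_mul_pulls_le (π : Policy N K) (α : Fin N → I) (i : Fin N) {T : ℕ}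
    (hT : 0 < T) : prob π α T (fun h => T < 2 * pulls h i) ≤
      2 * expect π α T (fun h => (pulls h i : ℝ)) / T := by
  have hT' : (0 : ℝ) < T := by positivity
  rw [mul_div_right_comm, prob, ← expect_const_mul]
  refine expect_mono π α T fun h => ?_
  split_ifs with hA
  · have : (T : ℝ) < 2 * pulls h i := by exact_mod_cast hA
    rw [div_mul_eq_mul_div, le_div_iff₀ hT']
    linarith
  · positivity

lemma prob_two_mul_pulls_le_le (π : Policy N K) (α : Fin N → I) (i : Fin N) {T : ℕ}
    (hT : 0 < T) : prob π α T (fun h => ¬ T < 2 * pulls h i) ≤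
      2 * (T - expect π α T (fun h => (pulls h i : ℝ))) / T := by
  have hT' : (0 : ℝ) < T := by positivity
  have h0 : (T : ℝ) - expect π α T (fun h => (pulls h i : ℝ)) =
      expect π α T (fun h => (T : ℝ) + (-1) * (pulls h i : ℝ)) := by
    rw [expect_add, expect_const, expect_const_mul]
    ring
  rw [mul_div_right_comm, h0, prob, ← expect_const_mul]
  refine expect_mono π α T fun h => ?_
  have h1 : (pulls h i : ℝ) ≤ T := by exact_mod_cast pulls_le h i
  split_ifs with hA
  · exact mul_nonneg (by positivity) (by linarith)
  · have : 2 * (pulls h i : ℝ) ≤ T := by exact_mod_cast not_lt.1 hA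
    rw [div_mul_eq_mul_div, le_div_iff₀ hT']
    linarith

lemma expect_pulls_nonneg (π : Policy N K) (α : Fin N → I) (i : Fin N) (T : ℕ) :
    0 ≤ expect π α T (fun h => (pulls h i : ℝ)) :=
  expect_nonneg π α T fun _ => Nat.cast_nonneg _

lemma mul_expect_pulls_le_expectedRegret (hε : 0 < ε) (hG : IsRestricted G) (π : Policy N 1)
    {α : Fin N → I} {iStar : Fin N} (hmax : ∀ i, α i ≤ α iStar) (i : Fin N) (T : ℕ) :
    scale ε * ((α iStar : ℝ) - α i) * expect π α T (fun h => (pulls h i : ℝ)) ≤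
      expectedRegret G ε π α T := by
  rw [expectedRegret_of_isRestricted hε hG π hmax]
  refine Finset.single_le_sum (f := fun i => scale ε * ((α iStar : ℝ) - α i) *
    expect π α T (fun h => (pulls h i : ℝ))) (fun j _ => ?_) (Finset.mem_univ i)
  have : (α j : ℝ) ≤ α iStar := hmax j
  exact mul_nonneg (mul_nonneg (scale_pos hε).le (sub_nonneg.2 this)) (expect_pulls_nonneg _ _ _ _)

/-- With K = 1 the pulls add up to T, so every round not spent on i costs at least the distance from
the best source i to the level a. -/
lemma mul_sub_expect_pulls_le_expectedRegret (hε : 0 < ε) (hG : IsRestricted G)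
    (π : Policy N 1) {α : Fin N → I} {i : Fin N} {a : ℝ} (ha : a ≤ α i)
    (hmax : ∀ j, j ≠ i → (α j : ℝ) ≤ a) (T : ℕ) :
    scale ε * ((α i : ℝ) - a) * (T - expect π α T (fun h => (pulls h i : ℝ))) ≤
      expectedRegret G ε π α T := by
  have hmax' : ∀ j, α j ≤ α i := fun j => by
    rcases eq_or_ne j i with rfl | hj
    · exact le_rfl
    · exact (hmax j hj).trans ha
  have hsum : ∑ j, expect π α T (fun h => (pulls h j : ℝ)) = T := by
    rw [← expect_sum]
    have : (fun h : History N 1 T => ∑ j, (pulls h j : ℝ)) = fun _ => (T : ℝ) := by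
      funext h
      exact_mod_cast (by rw [sum_pulls, mul_one] : ∑ j, pulls h j = T)
    rw [this, expect_const]
  rw [expectedRegret_of_isRestricted hε hG π hmax', ← hsum,
    ← Finset.add_sum_erase _ _ (Finset.mem_univ i), ← Finset.add_sum_erase Finset.univ
      (fun j => scale ε * ((α i : ℝ) - α j) * expect π α T (fun h => (pulls h j : ℝ)))
      (Finset.mem_univ i), add_sub_cancel_left, sub_self, mul_zero, zero_mul, zero_add,
    Finset.mul_sum]
  refine Finset.sum_le_sum fun j hj => ?_
  have := hmax j (Finset.ne_of_mem_erase hj)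
  exact mul_le_mul_of_nonneg_right (mul_le_mul_of_nonneg_left (by linarith) (scale_pos hε).le)
    (expect_pulls_nonneg _ _ _ _)

/-- A consistent policy has to tell `α` from the instance in which source `i` has the reliability
`q` instead and is the best one. -/
lemma eventually_le_expect_pulls_mul_klReal (hε : 0 < ε) (hG : IsRestricted G) {π : Policy N 1}
    (hπ : IsConsistent G ε π) {α : Fin N → I} {iStar : Fin N} (hmax : ∀ i, α i ≤ α iStar)
    {i : Fin N} (hi : α i < α iStar) {q : I} (hq : α iStar < q) (hq1 : q < 1) {p : ℝ}
    (hp : 0 < p) : ∀ᶠ T : ℕ in atTop, (1 - p) * Real.log T - 2 * Real.log 2 ≤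
      expect π α T (fun h => (pulls h i : ℝ)) * klReal (α i) q := by
  have hs := scale_pos hε
  have hi' : (α i : ℝ) < α iStar := hi
  have hq' : (α iStar : ℝ) < q := hq
  have hq01 : (q : ℝ) ∈ Set.Ioo (0 : ℝ) 1 := ⟨(α iStar).2.1.trans_lt hq', hq1⟩
  have hΔ : 0 < scale ε * ((α iStar : ℝ) - α i) := mul_pos hs (sub_pos.2 hi')
  have hΔ' : 0 < scale ε * ((q : ℝ) - α iStar) := mul_pos hs (sub_pos.2 hq')
  filter_upwards [(hπ α p hp).eventually_lt_const (half_pos hΔ),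
    (hπ (Function.update α i q) p hp).eventually_lt_const (half_pos hΔ'),
    eventually_gt_atTop 0] with T h1 h2 hT
  have hT' : (0 : ℝ) < T := by positivity
  have hTp : 0 < (T : ℝ) ^ p := by positivity
  rw [div_lt_iff₀ hTp] at h1 h2
  have h3 := mul_expect_pulls_le_expectedRegret hε hG π hmax i T
  have h4 := mul_sub_expect_pulls_le_expectedRegret (α := Function.update α i q) (i := i)
    (a := α iStar) hε hG π (by rw [Function.update_self]; exact hq'.le)
    (fun j hj => by rw [Function.update_of_ne hj]; exact hmax j) T
  rw [Function.update_self] at h4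
  have h5 : 2 * expect π α T (fun h => (pulls h i : ℝ)) ≤ (T : ℝ) ^ p := by
    refine le_of_mul_le_mul_left ?_ hΔ
    linarith
  have h6 : 2 * (T - expect π (Function.update α i q) T (fun h => (pulls h i : ℝ))) ≤
      (T : ℝ) ^ p := by
    refine le_of_mul_le_mul_left ?_ hΔ'
    linarith
  have h7 := (prob_lt_two_mul_pulls_le π α i hT).trans (div_le_div_of_nonneg_right h5 hT'.le)
  have h8 := (prob_two_mul_pulls_le_le π (Function.update α i q) i hT).trans
    (div_le_div_of_nonneg_right h6 hT'.le)
  -- Both error probabilities are at most T^p / T by Markov, so exp(-D/2) ≤ 2 √(T^p / T), with D the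
  -- expected pulls times the divergence; taking logarithms gives the claim.
  have h9 := exp_neg_half_le_sqrt_add_sqrt π α i q hq01 T (fun h => T < 2 * pulls h i)
  have h10 := h9.trans (add_le_add (Real.sqrt_le_sqrt h7) (Real.sqrt_le_sqrt h8))
  rw [← two_mul, ← Real.le_log_iff_exp_le (by positivity),
    Real.log_mul two_ne_zero (by positivity), Real.log_sqrt (by positivity),
    Real.log_div hTp.ne' hT'.ne', Real.log_rpow hT'] at h10
  linarith

lemma continuousAt_klReal {p q : ℝ} (hp1 : p < 1) (hq : q ∈ Set.Ioo (0 : ℝ) 1) :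
    ContinuousAt (klReal p) q := by
  have h1 : ContinuousAt (fun q : ℝ => p * Real.log (p / q)) q := by
    rcases eq_or_ne p 0 with rfl | hp
    · simpa using continuousAt_const
    · exact continuousAt_const.mul ((continuousAt_const.div continuousAt_id hq.1.ne').log
        (div_ne_zero hp hq.1.ne'))
  have hq1 : 1 - q ≠ 0 := (sub_pos.2 hq.2).ne'
  exact h1.add (continuousAt_const.mul ((continuousAt_const.div
    (continuousAt_const.sub continuousAt_id) hq1).log (div_ne_zero (sub_pos.2 hp1).ne' hq1)))

lemma klReal_pos {p q : ℝ} (hp : p ∈ Set.Icc (0 : ℝ) 1) (hq : q ∈ Set.Ioo (0 : ℝ) 1)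
    (hpq : p ≠ q) : 0 < klReal p q := by
  have := sq_sub_div_four_le_klReal hp (Set.Ioo_subset_Icc_self hq)
    (fun h => absurd h hq.1.ne') (fun h => absurd h hq.2.ne)
  have h2 : 0 < (p - q) ^ 2 := by
    have := sub_ne_zero.2 hpq
    positivity
  linarith

/-- A consistent policy selects a suboptimal source at least about `log T / kl` times. -/
lemma eventually_mul_log_le_expect_pulls (hε : 0 < ε) (hG : IsRestricted G) {π : Policy N 1}
    (hπ : IsConsistent G ε π) {α : Fin N → I} {iStar : Fin N} (hmax : ∀ i, α i ≤ α iStar)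
    (h1 : α iStar < 1) {i : Fin N} (hi : α i < α iStar) {x : ℝ}
    (hx : x < 1 / klReal (α i) (α iStar)) :
    ∀ᶠ T : ℕ in atTop, x * Real.log T ≤ expect π α T (fun h => (pulls h i : ℝ)) := by
  have hi' : (α i : ℝ) < α iStar := hi
  have h1' : (α iStar : ℝ) < 1 := h1
  have hs01 : (α iStar : ℝ) ∈ Set.Ioo (0 : ℝ) 1 := ⟨(α i).2.1.trans_lt hi', h1'⟩
  rw [lt_div_iff₀ (klReal_pos (α i).2 hs01 hi'.ne)] at hx
  have hc : Tendsto (fun q => x * klReal (α i) q) (𝓝[>] (α iStar : ℝ))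
      (𝓝 (x * klReal (α i) (α iStar))) :=
    ((continuousAt_klReal (hi'.trans h1') hs01).tendsto.const_mul x).mono_left nhdsWithin_le_nhds
  obtain ⟨q, hxq, hq⟩ := ((hc.eventually_lt_const hx).and (Ioo_mem_nhdsGT h1')).exists
  have hq01 : q ∈ Set.Ioo (0 : ℝ) 1 := ⟨hs01.1.trans hq.1, hq.2⟩
  have hk := klReal_pos (α i).2 hq01 (hi'.trans hq.1).ne
  -- Then x kl(α_i‖q) = 1 - 2p, and the spare p log T eventually absorbs 2 log 2.
  set p := (1 - x * klReal (α i) q) / 2 with hp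
  have hp0 : 0 < p := half_pos (sub_pos.2 hxq)
  have hlog : Tendsto (fun T : ℕ => p * Real.log T) atTop atTop :=
    (Real.tendsto_log_atTop.comp tendsto_natCast_atTop_atTop).const_mul_atTop hp0
  filter_upwards [eventually_le_expect_pulls_mul_klReal hε hG hπ hmax hi
    (q := ⟨q, Set.Ioo_subset_Icc_self hq01⟩) hq.1 hq.2 hp0,
    hlog.eventually_ge_atTop (2 * Real.log 2)] with T h2 h3
  refine le_of_mul_le_mul_right ?_ hk
  refine le_trans ?_ h2
  have : x * klReal (α i) q = 1 - 2 * p := by rw [hp]; ring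
  rw [mul_right_comm, this]
  linarith

lemma eventually_mul_log_le_expectedRegret (hε : 0 < ε) (hG : IsRestricted G) {π : Policy N 1}
    (hπ : IsConsistent G ε π) {α : Fin N → I} {iStar : Fin N} (hmax : ∀ i, α i ≤ α iStar)
    (h1 : α iStar < 1) {x : ℝ}
    (hx : x < ∑ i ∈ Finset.univ.filter (fun i => α i < α iStar),
      scale ε * ((α iStar : ℝ) - α i) / klReal (α i) (α iStar)) :
    ∀ᶠ T : ℕ in atTop, x * Real.log T ≤ expectedRegret G ε π α T := by
  set F := Finset.univ.filter (fun i => α i < α iStar) with hF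
  set Δ : Fin N → ℝ := fun i => scale ε * ((α iStar : ℝ) - α i) with hΔ
  have hΔ0 : ∀ i, 0 ≤ Δ i := fun i =>
    mul_nonneg (scale_pos hε).le (sub_nonneg.2 (hmax i : (α i : ℝ) ≤ α iStar))
  set M := ∑ i ∈ F, Δ i / klReal (α i) (α iStar) with hM
  have hD : 0 < 1 + ∑ i ∈ F, Δ i := by
    linarith [Finset.sum_nonneg fun i (_ : i ∈ F) => hΔ0 i]
  -- The slack M - x is shared among the sources; the 1 in the denominator keeps it positive when no
  -- source is suboptimal.
  set δ := (M - x) / (1 + ∑ i ∈ F, Δ i) with hδ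
  have hδ0 : 0 < δ := div_pos (sub_pos.2 hx) hD
  have hx' : x ≤ ∑ i ∈ F, Δ i * (1 / klReal (α i) (α iStar) - δ) := by
    have h2 : ∑ i ∈ F, Δ i * (1 / klReal (α i) (α iStar) - δ) = M - (∑ i ∈ F, Δ i) * δ := by
      rw [hM, Finset.sum_mul, ← Finset.sum_sub_distrib]
      exact Finset.sum_congr rfl fun i _ => by ring
    have h3 : (1 + ∑ i ∈ F, Δ i) * δ = M - x := by rw [hδ]; field_simp
    rw [h2]
    linarith
  have hev : ∀ᶠ T : ℕ in atTop, ∀ i ∈ F, (1 / klReal (α i) (α iStar) - δ) * Real.log T ≤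
      expect π α T (fun h => (pulls h i : ℝ)) :=
    (Finset.eventually_all F).2 fun i hi => eventually_mul_log_le_expect_pulls hε hG hπ hmax h1
      (Finset.mem_filter.1 hi).2 (by linarith)
  filter_upwards [hev, eventually_ge_atTop 1] with T hT hT1
  have hlog : 0 ≤ Real.log T := Real.log_nonneg (by exact_mod_cast hT1)
  rw [expectedRegret_of_isRestricted hε hG π hmax]
  calc x * Real.log T ≤ (∑ i ∈ F, Δ i * (1 / klReal (α i) (α iStar) - δ)) * Real.log T :=
        mul_le_mul_of_nonneg_right hx' hlog
    _ = ∑ i ∈ F, Δ i * ((1 / klReal (α i) (α iStar) - δ) * Real.log T) := by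
        rw [Finset.sum_mul]
        exact Finset.sum_congr rfl fun i _ => by ring
    _ ≤ ∑ i ∈ F, Δ i * expect π α T (fun h => (pulls h i : ℝ)) :=
        Finset.sum_le_sum fun i hi => mul_le_mul_of_nonneg_left (hT i hi) (hΔ0 i)
    _ ≤ _ := Finset.sum_le_sum_of_subset_of_nonneg (Finset.subset_univ F) fun i _ _ =>
        mul_nonneg (hΔ0 i) (expect_pulls_nonneg π α i T)

lemma log_isBigO_expectedRegret (hε : 0 < ε) (hG : IsRestricted G) {π : Policy N 1}
    (hπ : IsConsistent G ε π) {α : Fin N → I} {iStar : Fin N} (hmax : ∀ i, α i ≤ α iStar)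
    (h1 : α iStar < 1) (hsub : ∃ i, α i < α iStar) :
    (fun T : ℕ => Real.log T) =O[atTop] (fun T : ℕ => expectedRegret G ε π α T) := by
  set M := ∑ i ∈ Finset.univ.filter (fun i => α i < α iStar),
      scale ε * ((α iStar : ℝ) - α i) / klReal (α i) (α iStar) with hM
  have hM0 : 0 < M := by
    obtain ⟨i, hi⟩ := hsub
    refine Finset.sum_pos (fun j hj => ?_) ⟨i, by simpa using hi⟩
    have hj : (α j : ℝ) < α iStar := (Finset.mem_filter.1 hj).2
    exact div_pos (mul_pos (scale_pos hε) (sub_pos.2 hj))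
      (klReal_pos (α j).2 ⟨(α j).2.1.trans_lt hj, h1⟩ hj.ne)
  refine IsBigO.of_bound (2 / M) ?_
  filter_upwards [eventually_mul_log_le_expectedRegret hε hG hπ hmax h1 (half_lt_self hM0),
    eventually_ge_atTop 1] with T hT hT1
  rw [Real.norm_of_nonneg (Real.log_nonneg (by exact_mod_cast hT1)),
    Real.norm_of_nonneg (expectedRegret_nonneg G α ε π T), div_mul_eq_mul_div, le_div_iff₀ hM0]
  linarith

end restricted

/-! ### Consistency, the limit inferior bound and impossibility. -/

lemma isConsistent_of_isBigO_log {G : Matrix (Fin N) (Fin N) ℝ} {ε : ℝ} {π : Policy N K}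
    (h : ∀ α : Fin N → I,
      (fun T : ℕ => expectedRegret G ε π α T) =O[atTop] (fun T : ℕ => Real.log T)) :
    IsConsistent G ε π := fun α _ hp =>
  ((h α).trans_isLittleO ((isLittleO_log_rpow_atTop hp).comp_tendsto
    tendsto_natCast_atTop_atTop)).tendsto_div_nhds_zero

/-- The instance-dependent lower bound for consistent policies. -/
theorem le_liminf_expectedRegret_div_log {G : Matrix (Fin N) (Fin N) ℝ} {ε : ℝ} (hε : 0 < ε)
    (hG : IsRestricted G) {π : Policy N 1} (hπ : IsConsistent G ε π) {α : Fin N → I}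
    {iStar : Fin N} (hmax : ∀ i, α i ≤ α iStar) :
    ((∑ i ∈ Finset.univ.filter (fun i => α i < α iStar),
        ENNReal.ofReal (scale ε * ((α iStar : ℝ) - (α i : ℝ))) /
          kl (α i : ℝ) (α iStar : ℝ) : ℝ≥0∞) : EReal) ≤
      liminf (fun T : ℕ => ((expectedRegret G ε π α T / Real.log T : ℝ) : EReal)) atTop := by
  -- At optimum 1 every divergence in the sum is infinite, so the bound is 0 and only nonnegativity
  -- of the regret is needed.
  rcases eq_or_ne (α iStar) 1 with h1 | h1
  · have h0 : ∑ i ∈ Finset.univ.filter (fun i => α i < α iStar),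
        ENNReal.ofReal (scale ε * ((α iStar : ℝ) - (α i : ℝ))) /
          kl (α i : ℝ) (α iStar : ℝ) = 0 := by
      refine Finset.sum_eq_zero fun i hi => ?_
      have hi : α i < α iStar := (Finset.mem_filter.1 hi).2
      rw [h1] at hi ⊢
      have hne : (α i : ℝ) ≠ 1 := ne_of_lt (show (α i : ℝ) < 1 from hi)
      rw [kl, if_pos (Or.inr ⟨rfl, hne⟩), ENNReal.div_top]
    rw [h0, EReal.coe_ennreal_zero]
    refine le_liminf_of_le (by isBoundedDefault) ?_
    filter_upwards [eventually_ge_atTop 1] with T hT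
    exact EReal.coe_nonneg.2 (div_nonneg (expectedRegret_nonneg G α ε π T)
      (Real.log_nonneg (by exact_mod_cast hT)))
  · have hlt : α iStar < 1 := lt_of_le_of_ne (α iStar).2.2 h1
    have hsum : ∑ i ∈ Finset.univ.filter (fun i => α i < α iStar),
        ENNReal.ofReal (scale ε * ((α iStar : ℝ) - (α i : ℝ))) /
          kl (α i : ℝ) (α iStar : ℝ) =
        ENNReal.ofReal (∑ i ∈ Finset.univ.filter (fun i => α i < α iStar),
          scale ε * ((α iStar : ℝ) - α i) / klReal (α i) (α iStar)) := by
      have hpos : ∀ i ∈ Finset.univ.filter (fun i => α i < α iStar),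
          0 < klReal (α i) (α iStar) ∧ (0 : ℝ) < α iStar ∧ (α i : ℝ) < α iStar := by
        intro i hi
        have hi : (α i : ℝ) < α iStar := (Finset.mem_filter.1 hi).2
        have h0 := (α i).2.1.trans_lt hi
        exact ⟨klReal_pos (α i).2 ⟨h0, hlt⟩ hi.ne, h0, hi⟩
      rw [ENNReal.ofReal_sum_of_nonneg fun i hi => div_nonneg
        (mul_nonneg (scale_pos hε).le (sub_nonneg.2 (hpos i hi).2.2.le)) (hpos i hi).1.le]
      refine Finset.sum_congr rfl fun i hi => ?_
      rw [kl_eq_ofReal (hpos i hi).2.1.ne' (ne_of_lt (show (α iStar : ℝ) < 1 from hlt)),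
        ENNReal.ofReal_div_of_pos (hpos i hi).1]
    rw [hsum, EReal.coe_ennreal_ofReal, max_eq_left (Finset.sum_nonneg fun i hi => by
      have hi : (α i : ℝ) < α iStar := (Finset.mem_filter.1 hi).2
      exact div_nonneg (mul_nonneg (scale_pos hε).le (sub_nonneg.2 hi.le))
        (klReal_pos (α i).2 ⟨(α i).2.1.trans_lt hi, hlt⟩ hi.ne).le), le_liminf_iff]
    intro y hy
    obtain ⟨x, hyx, hx⟩ := EReal.lt_iff_exists_real_btwn.1 hy
    filter_upwards [eventually_mul_log_le_expectedRegret hε hG hπ hmax hlt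
      (EReal.coe_lt_coe_iff.1 hx), eventually_gt_atTop 1] with T hT hT1
    refine hyx.trans_le (EReal.coe_le_coe_iff.2 ?_)
    rwa [le_div_iff₀ (Real.log_pos (by exact_mod_cast hT1))]

/-- No policy has regret `o(log T)` on all instances. -/
theorem not_exists_expectedRegret_isLittleO_log {G : Matrix (Fin N) (Fin N) ℝ} {ε : ℝ}
    (hε : 0 < ε) (hN : 2 ≤ N) (hG : IsRestricted G) :
    ¬ ∃ π : Policy N 1, ∀ α : Fin N → I,
      (fun T : ℕ => expectedRegret G ε π α T) =o[atTop] (fun T : ℕ => Real.log T) := by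
  rintro ⟨π, hπ⟩
  have hcons := isConsistent_of_isBigO_log fun α => (hπ α).isBigO
  set i₀ : Fin N := ⟨0, by omega⟩ with hi₀
  set i₁ : Fin N := ⟨1, by omega⟩ with hi₁
  have hne : i₁ ≠ i₀ := by simp [hi₀, hi₁]
  set a : I := ⟨1 / 2, by norm_num⟩ with ha
  have ha0 : (0 : I) < a := by
    rw [← Subtype.coe_lt_coe]
    norm_num [ha]
  have ha1 : a < 1 := by
    rw [← Subtype.coe_lt_coe]
    norm_num [ha]
  -- One source at 1/2 and the others at 0: the optimum is below 1 and some source is suboptimal, so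
  -- consistency forces regret of order at least log T.
  set α : Fin N → I := fun i => if i = i₀ then a else 0 with hα
  have hα0 : α i₀ = a := by simp [hα]
  have hα1 : α i₁ = 0 := by simp [hα, hne]
  have hmax : ∀ i, α i ≤ α i₀ := fun i => by
    rw [hα0, hα]
    dsimp only
    split_ifs
    · exact le_rfl
    · exact ha0.le
  have h := (log_isBigO_expectedRegret hε hG hcons hmax (by rwa [hα0])
    ⟨i₁, by rwa [hα0, hα1]⟩).trans_isLittleO (hπ α)
  refine isLittleO_irrefl (Eventually.frequently ?_) h
  filter_upwards [eventually_gt_atTop 1] with T hT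
  exact (Real.log_pos (by exact_mod_cast hT)).ne'

end

end ProbDPP

open ProbDPP in
theorem mainTheorem2 (ε : ℝ) (hε : 0 < ε) (c : ℝ) (hc : 0 < c) :
    -- the instance-dependent lower bound for consistent policies on the restricted instance
    (∀ (N : ℕ) (G : Matrix (Fin N) (Fin N) ℝ), IsRestricted G →
      ∀ π : Policy N 1, IsConsistent G ε π →
      ∀ (α : Fin N → I) (iStar : Fin N), (∀ i, α i ≤ α iStar) →
        ((∑ i ∈ Finset.univ.filter (fun i => α i < α iStar),
            ENNReal.ofReal (scale ε * ((α iStar : ℝ) - (α i : ℝ))) /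
              kl (α i : ℝ) (α iStar : ℝ) : ℝ≥0∞) : EReal) ≤
          liminf (fun T : ℕ => ((expectedRegret G ε π α T / Real.log T : ℝ) : EReal)) atTop) ∧
    -- no policy has regret `o(log T)` on all instances
    (∀ (N : ℕ) (G : Matrix (Fin N) (Fin N) ℝ), 2 ≤ N → IsRestricted G →
      ¬ ∃ π : Policy N 1, ∀ α : Fin N → I,
        (fun T : ℕ => expectedRegret G ε π α T) =o[atTop] (fun T : ℕ => Real.log T)) ∧
    -- the algorithm has regret `O(log T)` on every instance, for every budget and kernel
    (∀ (N K : ℕ) (G : Matrix (Fin N) (Fin N) ℝ), IsKernel K G →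
      ∀ π : Policy N K, IsProbDPP G ε c π → ∀ α : Fin N → I,
        (fun T : ℕ => expectedRegret G ε π α T) =O[atTop] (fun T : ℕ => Real.log T)) ∧
    -- on the restricted instance this order is attained, and no consistent policy beats it
    (∀ (N : ℕ) (G : Matrix (Fin N) (Fin N) ℝ), IsRestricted G →
      ∀ π : Policy N 1, IsProbDPP G ε c π →
        IsConsistent G ε π ∧
        ∀ (α : Fin N → I) (iStar : Fin N), (∀ i, α i ≤ α iStar) → α iStar < 1 →
          (∃ i, α i < α iStar) →
          (fun T : ℕ => expectedRegret G ε π α T) =Θ[atTop] (fun T : ℕ => Real.log T) ∧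
          ∀ π' : Policy N 1, IsConsistent G ε π' →
            (fun T : ℕ => expectedRegret G ε π α T) =O[atTop]
              (fun T : ℕ => expectedRegret G ε π' α T)) := by
  refine ⟨fun N G hG π hπ α iStar hmax => le_liminf_expectedRegret_div_log hε hG hπ hmax,
    fun N G hN hG => not_exists_expectedRegret_isLittleO_log hε hN hG,
    fun N K G _ π hπ α => expectedRegret_isBigO_log G α hε hc hπ, fun N G hG π hπ => ?_⟩
  have hO := fun α => expectedRegret_isBigO_log G α hε hc hπ
  have hcons := isConsistent_of_isBigO_log hO
  exact ⟨hcons, fun α iStar hmax h1 hsub =>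
    ⟨⟨hO α, log_isBigO_expectedRegret hε hG hcons hmax h1 hsub⟩, fun π' hπ' =>
      (hO α).trans (log_isBigO_expectedRegret hε hG hπ' hmax h1 hsub)⟩⟩
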